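/- Let $y_i=\beta\xi_i+\alpha+\delta_i$, $x_i=\xi_i+\varepsilon_i$, $i\ge 1$, with real $\alpha$ and $\beta\neq 0$, be a linear structural error-in-variables model such that: (A) $(\delta_i,\varepsilon_i)$, $i\ge1$, are i.i.d. copies of a mean-zero vector $(\delta,\varepsilon)$ with $E\delta^4<\infty$, $E\varepsilon^4<\infty$ and positive definite covariance matrix $\begin{pmatrix}\lambda\theta&\mu\\ \mu&\theta\end{pmatrix}$; (C) $\xi_i$, $i\ge1$, are i.i.d. copies of a random variable $\xi$, and the sequence $(\xi_i)$ is independent of the sequence $((\delta_i,\varepsilon_i))$; and such that $\xi$ is not almost surely constant and $E|\xi|^{8/3}<\infty$. The values $\lambda\theta=\operatorname{Var}\delta$ and $\mu=\operatorname{cov}(\delta,\varepsilon)$ are known. Put $c=0$ if $\alpha$ is known to be zero (model without intercept) and $c=1$ if $\alpha$ is unknown. For $u,v\in\{x,y\}$ let $\bar u=\frac1n\sum_{i=1}^n u_i$, $s_{i,uv}=(u_i-c\bar u)(v_i-c\bar v)$, $S_{uv}=\frac1n\sum_{i=1}^n s_{i,uv}$, and let $$\widehat\beta_{1n}=\frac{S_{yy}-\lambda\theta}{S_{xy}-\mu}\quad\text{if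 } S_{xy}-\mu\ne0 \text{ and } S_{yy}-\lambda\theta>0 .$$ For $0<\gamma<1$ let $z=z_{\gamma/2}$ be the number with $\Phi(z)=1-\gamma/2$, $\Phi$ the standard normal distribution function. Let $f_1(n)=n(n-1)$, $f_2(n)=n^2$, $g_1^{yy}=S_{yy}$, $g_2^{yy}=\lambda\theta$, $g_1^{xy}=S_{xy}$, $g_2^{xy}=\mu$, and for $k,l\in\{1,2\}$ let $$D_k=4z^2f_k(n)(S_{xy}-\mu)^2\sum_{i=1}^n\Big((s_{i,yy}-g_k^{yy})-\widehat\beta_{1n}(s_{i,xy}-g_k^{xy})\Big)^2-4z^4\Big(\sum_{i=1}^n(s_{i,yy}-g_k^{yy})^2\sum_{i=1}^n(s_{i,xy}-g_k^{xy})^2-\Big(\sum_{i=1}^n(s_{i,yy}-g_k^{yy})(s_{i,xy}-g_k^{xy})\Big)^2\Big),$$ $$B_k^l=\frac{f_k(n)(S_{xy}-\mu)^2\widehat\beta_{1n}-z^2\sum_{i=1}^n(s_{i,yy}-g_k^{yy})(s_{i,xy}-g_k^{xy})+(-1)^l\sqrt{D_k/4}}{f_k(n)(S_{xy}-\mu)^2-z^2\sum_{i=1}^n(s_{i,xy}-g_k^{xy})^2}.$$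 Then $\xi$ is in the domain of attraction of the normal law, i.e. $\big(\sum_{i=1}^n\xi_i-a_n\big)b_n^{-1}\to N(0,1)$ in distribution for some constants $a_n$ and $b_n>0$. Moreover, both for the model without intercept and for the model with unknown intercept, and for $k=1$ and $k=2$, $[B_k^1,B_k^2]$ is a large-sample approximate $1-\gamma$ confidence interval for $\beta$: $$P\big(B_k^1,B_k^2 \text{ are defined real numbers and } B_k^1\le\beta\le B_k^2\big)\to1-\gamma,\qquad n\to\infty .$$ It is the interval given by the Studentized ($k=1$), respectively self-normalized ($k=2$), statistic for $\beta$: with $u_i(b)=(s_{i,yy}-\lambda\theta)-b\,(s_{i,xy}-\mu)$ and $\overline{u(b)}=\frac1n\sum_{i=1}^n u_i(b)$, with probability tending to $1$ the numbers $B_k^1<B_k^2$ are defined and $[B_k^1,B_k^2]$ equals the set of all real $b$ such that $$\sqrt n\,\big|(S_{xy}-\mu)(\widehat\beta_{1n}-b)\big|\le z\Big(\sum_{i=1}^n\big(u_i(b)-\overline{u(b)}\big)^2/(n-1)\Big)^{1/2}\ (k=1),\qquad n\,\big|(S_{xy}-\mu)(\widehat\beta_{1n}-b)\big|\le z\Big(\sum_{i=1}^n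 u_i(b)^2\Big)^{1/2}\ (k=2).$$ -/

import Mathlib

open MeasureTheory ProbabilityTheory Filter Topology

namespace SEIVM

noncomputable section

/-! ### Sample quantities of observed numbers `u 0, …, u (n - 1)` -/

/-- Sample mean of the first `n` terms. -/
def mean (u : ℕ → ℝ) (n : ℕ) : ℝ := (∑ i ∈ Finset.range n, u i) / n

/-- `s_{i,uv} = (u_i - c ū)(v_i - c v̄)`. -/
def s (c : ℝ) (u v : ℕ → ℝ) (n i : ℕ) : ℝ := (u i - c * mean u n) * (v i - c * mean v n)

/-- `S_{uv}`, the sample mean of the `s_{i,uv}`. -/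
def S (c : ℝ) (u v : ℕ → ℝ) (n : ℕ) : ℝ := mean (s c u v n) n

/-! ### The estimator of the slope

Here and below `dd` is the known error variance `Var δ = λθ`, and `mu` the known error
covariance `cov(δ, ε)`. -/

/-- The modified least squares estimator `(S_yy - λθ) / (S_xy - μ)` of the slope. -/
def betaHat (c dd mu : ℝ) (x y : ℕ → ℝ) (n : ℕ) : ℝ := (S c y y n - dd) / (S c x y n - mu)

/-- The condition under which the estimator of the slope is defined. -/
def BetaHatDefined (c dd mu : ℝ) (x y : ℕ → ℝ) (n : ℕ) : Prop :=
  S c x y n - mu ≠ 0 ∧ 0 < S c y y n - dd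

/-! ### The two confidence intervals -/

/-- The two constructions: `studentized` is `k = 1`, `selfNormalized` is `k = 2`. -/
inductive Kind
  | studentized
  | selfNormalized

/-- `f_k(n)`. -/
def f : Kind → ℕ → ℝ
  | .studentized, n => (n : ℝ) * ((n : ℝ) - 1)
  | .selfNormalized, n => (n : ℝ) ^ 2

/-- The centring `g_k^{yy}`. -/
def gyy (k : Kind) (c dd : ℝ) (y : ℕ → ℝ) (n : ℕ) : ℝ :=
  match k with
  | .studentized => S c y y n
  | .selfNormalized => dd

/-- The centring `g_k^{xy}`. -/
def gxy (k : Kind) (c mu : ℝ) (x y : ℕ → ℝ) (n : ℕ) : ℝ :=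
  match k with
  | .studentized => S c x y n
  | .selfNormalized => mu

/-- The discriminant `D_k(n, z)`. -/
def D (k : Kind) (c dd mu z : ℝ) (x y : ℕ → ℝ) (n : ℕ) : ℝ :=
  4 * z ^ 2 * f k n * (S c x y n - mu) ^ 2 *
      (∑ i ∈ Finset.range n,
        ((s c y y n i - gyy k c dd y n)
          - betaHat c dd mu x y n * (s c x y n i - gxy k c mu x y n)) ^ 2)
    - 4 * z ^ 4 *
      ((∑ i ∈ Finset.range n, (s c y y n i - gyy k c dd y n) ^ 2) *
          (∑ i ∈ Finset.range n, (s c x y n i - gxy k c mu x y n) ^ 2)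
        - (∑ i ∈ Finset.range n,
            (s c y y n i - gyy k c dd y n) * (s c x y n i - gxy k c mu x y n)) ^ 2)

/-- The denominator of the endpoints. -/
def denom (k : Kind) (c mu z : ℝ) (x y : ℕ → ℝ) (n : ℕ) : ℝ :=
  f k n * (S c x y n - mu) ^ 2
    - z ^ 2 * ∑ i ∈ Finset.range n, (s c x y n i - gxy k c mu x y n) ^ 2

/-- The endpoints `B_k^l(n, z)`, `l = 1, 2`. -/
def B (k : Kind) (l : ℕ) (c dd mu z : ℝ) (x y : ℕ → ℝ) (n : ℕ) : ℝ :=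
  (f k n * (S c x y n - mu) ^ 2 * betaHat c dd mu x y n
      - z ^ 2 * (∑ i ∈ Finset.range n,
          (s c y y n i - gyy k c dd y n) * (s c x y n i - gxy k c mu x y n))
      + (-1) ^ l * √(D k c dd mu z x y n / 4))
    / denom k c mu z x y n

/-- The interval `[B_k^1(n, z), B_k^2(n, z)]`. -/
def interval (k : Kind) (c dd mu z : ℝ) (x y : ℕ → ℝ) (n : ℕ) : Set ℝ :=
  Set.Icc (B k 1 c dd mu z x y n) (B k 2 c dd mu z x y n)

/-- All expressions in the formula for the endpoints make sense as real numbers. -/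
def IntervalDefined (k : Kind) (c dd mu z : ℝ) (x y : ℕ → ℝ) (n : ℕ) : Prop :=
  BetaHatDefined c dd mu x y n ∧ 0 ≤ D k c dd mu z x y n ∧ denom k c mu z x y n ≠ 0

/-! ### The Studentized and self-normalized pivots -/

/-- `u_i(n) = (s_{i,yy} - λθ) - b (s_{i,xy} - μ)`, with a candidate value `b` for the slope. -/
def u (b c dd mu : ℝ) (x y : ℕ → ℝ) (n i : ℕ) : ℝ :=
  (s c y y n i - dd) - b * (s c x y n i - mu)

/-- The set of all candidate values `b` of the slope whose Studentized (resp. self-normalized)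
pivot is at most `z` in absolute value; the inequality is multiplied by the normalizer. -/
def pivotSet (k : Kind) (c dd mu z : ℝ) (x y : ℕ → ℝ) (n : ℕ) : Set ℝ :=
  match k with
  | .studentized =>
      {b | |√(n : ℝ) * (S c x y n - mu) * (betaHat c dd mu x y n - b)| ≤
        z * √((∑ i ∈ Finset.range n,
          (u b c dd mu x y n i - mean (u b c dd mu x y n) n) ^ 2) / ((n : ℝ) - 1))}
  | .selfNormalized =>
      {b | |(n : ℝ) * (S c x y n - mu) * (betaHat c dd mu x y n - b)| ≤
        z * √(∑ i ∈ Finset.range n, u b c dd mu x y n i ^ 2)}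

/-! ### The model -/

variable {Ω : Type*} [MeasurableSpace Ω]

/-- `X i` are i.i.d. random elements. -/
structure IID {E : Type*} [MeasurableSpace E] (P : Measure Ω) (X : ℕ → Ω → E) : Prop where
  measurable : ∀ i, Measurable (X i)
  indep : iIndepFun X P
  ident : ∀ i, IdentDistrib (X i) (X 0) P P

/-- The real random variables `X i` are i.i.d. in the domain of attraction of the normal law. -/
def IIDInDAN (P : Measure Ω) [IsProbabilityMeasure P] (X : ℕ → Ω → ℝ) : Prop :=
  IID P X ∧ ∃ a b : ℕ → ℝ, (∀ n, 0 < b n) ∧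
    TendstoInDistribution (fun n ω => ((∑ i ∈ Finset.range n, X i ω) - a n) * (b n)⁻¹) atTop
      (id : ℝ → ℝ) (fun _ => P) (gaussianReal 0 1)

/-- The condition on the errors: i.i.d. centred vectors with finite fourth moments and positive
definite covariance matrix with rows `(λθ, μ)` and `(μ, θ)`. -/
structure ErrorCondition (P : Measure Ω) (δ ε : ℕ → Ω → ℝ) (lam θ mu : ℝ) : Prop where
  iid : IID P (fun i ω => (δ i ω, ε i ω))
  integrable_δ : Integrable (fun ω => δ 0 ω ^ 4) P
  integrable_ε : Integrable (fun ω => ε 0 ω ^ 4) P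
  mean_δ : ∫ ω, δ 0 ω ∂P = 0
  mean_ε : ∫ ω, ε 0 ω ∂P = 0
  var_δ : Var[δ 0; P] = lam * θ
  cov_δε : cov[δ 0, ε 0; P] = mu
  var_ε : Var[ε 0; P] = θ
  posDef : (!![lam * θ, mu; mu, θ] : Matrix (Fin 2) (Fin 2) ℝ).PosDef

/-- The observed responses `y_i = β ξ_i + α + δ_i`, at the outcome `ω`. -/
def obsY (β α : ℝ) (ξ δ : ℕ → Ω → ℝ) (ω : Ω) (i : ℕ) : ℝ := β * ξ i ω + α + δ i ω

/-- The observed regressors `x_i = ξ_i + ε_i`, at the outcome `ω`. -/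
def obsX (ξ ε : ℕ → Ω → ℝ) (ω : Ω) (i : ℕ) : ℝ := ξ i ω + ε i ω

end

end SEIVM

/-!
Both statistics for `β` have `n⁻¹ ∑ u_i(b) = (S_xy - μ)(β̂ - b)` as numerator and a sum of squares
quadratic in `b` as normalizer, so the condition that the statistic is at most `z` in absolute value
is a quadratic inequality in `b`. Its leading coefficient is the denominator of the endpoints; when
this is positive, completing the square turns the inequality into `B_1 ≤ b ≤ B_2`, as in Fieller's
method.

For the limits, `u_i(b)` is, up to a constant, the product of the `c`-centred `y_i` and
`y_i - b x_i`, and replacing the sample means in it by expectations costs only a term of order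
`√n (ȳ - E y)(x̄ - E x) → 0`. At `b = β` the law of large numbers, the central limit theorem and
Slutsky's theorem give the limit law `N(0, 1)`. The limiting variance is positive because
`u_i(β)` contains the product of `β (ξ_i - E ξ)` with the independent nondegenerate
`δ_i - β ε_i`. The denominator is positive almost surely for all large `n`, because the mean of
`s_{i,xy}²` is `o(n)` even without a second moment of `s_{i,xy}`: the mean of nonnegative products
`v_i w_i` is at most the mean of the `w_i` times `max_{i ≤ n} v_i = o(n)`.
-/

namespace SEIVM

section Fieller

lemma discriminant_eq (F A C Q t w : ℝ) :
    w * F * (A - 2 * t * C + t ^ 2 * Q) - w ^ 2 * (A * Q - C ^ 2) =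
      w * (A - 2 * t * C + t ^ 2 * Q) * (F - w * Q) + (F * t - w * C - (F - w * Q) * t) ^ 2 := by
  ring

lemma mem_Icc_iff_quadratic_le {F A C Q t w r b : ℝ} (hden : 0 < F - w * Q) (hr : 0 ≤ r)
    (hr2 : r ^ 2 = w * F * (A - 2 * t * C + t ^ 2 * Q) - w ^ 2 * (A * Q - C ^ 2)) :
    b ∈ Set.Icc ((F * t - w * C - r) / (F - w * Q)) ((F * t - w * C + r) / (F - w * Q)) ↔
      F * (t - b) ^ 2 ≤ w * (A - 2 * b * C + b ^ 2 * Q) := by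
  have completed_square : ((F - w * Q) * b - (F * t - w * C)) ^ 2 - r ^ 2 =
      (F - w * Q) * (F * (t - b) ^ 2 - w * (A - 2 * b * C + b ^ 2 * Q)) := by rw [hr2]; ring
  calc b ∈ Set.Icc ((F * t - w * C - r) / (F - w * Q)) ((F * t - w * C + r) / (F - w * Q))
      ↔ |(F - w * Q) * b - (F * t - w * C)| ≤ r := by
        rw [Set.mem_Icc, div_le_iff₀ hden, le_div_iff₀ hden, abs_le]
        constructor <;> rintro ⟨h₁, h₂⟩ <;> constructor <;> linarith
    _ ↔ ((F - w * Q) * b - (F * t - w * C)) ^ 2 - r ^ 2 ≤ 0 := by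
        rw [sub_nonpos, sq_le_sq, abs_of_nonneg hr]
    _ ↔ F * (t - b) ^ 2 ≤ w * (A - 2 * b * C + b ^ 2 * Q) := by
        rw [completed_square, ← mul_zero (F - w * Q), mul_le_mul_iff_right₀ hden, sub_nonpos]

end Fieller

/-- The residual `(s_{i,yy} - g_k^{yy}) - b (s_{i,xy} - g_k^{xy})` at a candidate slope `b`: it is
`u_i(b)` for the self-normalized construction and `u_i(b)` minus its sample mean for the
Studentized one. -/
noncomputable def resid (k : Kind) (b c dd mu : ℝ) (x y : ℕ → ℝ) (n i : ℕ) : ℝ :=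
  (s c y y n i - gyy k c dd y n) - b * (s c x y n i - gxy k c mu x y n)

/-- The sum of squares by which the Studentized and self-normalized statistics are normalized. -/
noncomputable def residSq (k : Kind) (b c dd mu : ℝ) (x y : ℕ → ℝ) (n : ℕ) : ℝ :=
  ∑ i ∈ Finset.range n, resid k b c dd mu x y n i ^ 2

/-- The Studentized or self-normalized statistic for the slope, at a candidate slope `b`. -/
noncomputable def pivot (k : Kind) (b c dd mu : ℝ) (x y : ℕ → ℝ) (n : ℕ) : ℝ :=
  √(f k n) * mean (u b c dd mu x y n) n / √(residSq k b c dd mu x y n)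

section SampleMean

variable {v w : ℕ → ℝ}

lemma sum_range_eq_mul_mean (v : ℕ → ℝ) (n : ℕ) : ∑ i ∈ Finset.range n, v i = n * mean v n := by
  rcases eq_or_ne n 0 with rfl | hn
  · simp
  · rw [mean]; field_simp

lemma mean_add (v w : ℕ → ℝ) (n : ℕ) : mean (fun i => v i + w i) n = mean v n + mean w n := by
  simp only [mean, Finset.sum_add_distrib, add_div]

lemma mean_sub (v w : ℕ → ℝ) (n : ℕ) : mean (fun i => v i - w i) n = mean v n - mean w n := by
  simp only [mean, Finset.sum_sub_distrib, sub_div]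

lemma mean_const_mul (r : ℝ) (v : ℕ → ℝ) (n : ℕ) : mean (fun i => r * v i) n = r * mean v n := by
  simp only [mean, ← Finset.mul_sum, mul_div_assoc]

lemma mean_const (r : ℝ) {n : ℕ} (hn : n ≠ 0) : mean (fun _ => r) n = r := by
  simp only [mean, Finset.sum_const, Finset.card_range, nsmul_eq_mul]
  field_simp

lemma mean_nonneg {n : ℕ} (h : ∀ i, 0 ≤ v i) : 0 ≤ mean v n :=
  div_nonneg (Finset.sum_nonneg fun i _ => h i) n.cast_nonneg

lemma mean_mono (h : ∀ i, v i ≤ w i) (n : ℕ) : mean v n ≤ mean w n := by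
  unfold mean
  gcongr with i
  exact h i

lemma mean_mul_sq_le (v w : ℕ → ℝ) (n : ℕ) :
    mean (fun i => v i * w i) n ^ 2 ≤ mean (fun i => v i ^ 2) n * mean (fun i => w i ^ 2) n := by
  simp only [mean, div_pow, div_mul_div_comm, ← sq]
  gcongr
  exact Finset.sum_mul_sq_le_sq_mul_sq _ _ _

lemma s_eq_sub_mul_sub (c a b : ℝ) (v w : ℕ → ℝ) (n i : ℕ) :
    s c v w n i = (v i - c * a - c * (mean v n - a)) * (w i - c * b - c * (mean w n - b)) := by
  rw [s]; ring

lemma S_eq_mean_sub {c : ℝ} (hc : c ^ 2 = c) (a b : ℝ) (v w : ℕ → ℝ) {n : ℕ} (hn : n ≠ 0) :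
    S c v w n =
      mean (fun i => (v i - c * a) * (w i - c * b)) n - c * (mean v n - a) * (mean w n - b) := by
  have expand (i : ℕ) : s c v w n i = (v i - c * a) * (w i - c * b)
      - (c * (mean w n - b) * v i + c * (mean v n - a) * w i)
      + c * (mean v n * mean w n - a * b) := by
    rw [s]; linear_combination (mean v n * mean w n - a * b) * hc
  rw [S, funext expand, mean_add, mean_sub, mean_add, mean_const_mul, mean_const_mul,
    mean_const _ hn]
  ring

end SampleMean

section Statistic

variable {k : Kind} {b c dd mu z : ℝ} {x y : ℕ → ℝ} {n : ℕ}

lemma u_eq_s_sub (b c dd mu : ℝ) (x y : ℕ → ℝ) (n i : ℕ) :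
    u b c dd mu x y n i = s c y (fun i => y i - b * x i) n i - (dd - b * mu) := by
  rw [s, mean_sub, mean_const_mul, u, s, s]
  ring

lemma mean_u (hn : n ≠ 0) :
    mean (u b c dd mu x y n) n = (S c y y n - dd) - b * (S c x y n - mu) := by
  unfold u
  rw [mean_sub, mean_const_mul, mean_sub, mean_sub, mean_const _ hn, mean_const _ hn, S, S]

lemma mean_u_eq_S_sub (hn : n ≠ 0) :
    mean (u b c dd mu x y n) n = S c y (fun i => y i - b * x i) n - (dd - b * mu) := by
  rw [funext (u_eq_s_sub b c dd mu x y n), mean_sub, mean_const _ hn, S]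

lemma mul_betaHat_sub (hn : n ≠ 0) (hS : S c x y n - mu ≠ 0) :
    (S c x y n - mu) * (betaHat c dd mu x y n - b) = mean (u b c dd mu x y n) n := by
  rw [mean_u hn, betaHat]
  field_simp

lemma resid_studentized (hn : n ≠ 0) (i : ℕ) :
    resid .studentized b c dd mu x y n i =
      u b c dd mu x y n i - mean (u b c dd mu x y n) n := by
  rw [mean_u hn, resid, gyy, gxy, u]
  ring

lemma resid_betaHat (hn : n ≠ 0) (hS : S c x y n - mu ≠ 0) (i : ℕ) :
    resid k (betaHat c dd mu x y n) c dd mu x y n i =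
      u (betaHat c dd mu x y n) c dd mu x y n i := by
  cases k
  · rw [resid_studentized hn, ← mul_betaHat_sub hn hS, sub_self, mul_zero, sub_zero]
  · rfl

lemma residSq_nonneg : 0 ≤ residSq k b c dd mu x y n :=
  Finset.sum_nonneg fun _ _ => sq_nonneg _

lemma residSq_eq (b : ℝ) :
    residSq k b c dd mu x y n =
      ∑ i ∈ Finset.range n, (s c y y n i - gyy k c dd y n) ^ 2
      - 2 * b * ∑ i ∈ Finset.range n,
          (s c y y n i - gyy k c dd y n) * (s c x y n i - gxy k c mu x y n)
      + b ^ 2 * ∑ i ∈ Finset.range n, (s c x y n i - gxy k c mu x y n) ^ 2 := by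
  simp only [residSq, Finset.mul_sum, ← Finset.sum_sub_distrib, ← Finset.sum_add_distrib, resid]
  exact Finset.sum_congr rfl fun i _ => by ring

lemma D_div_four :
    D k c dd mu z x y n / 4 =
      z ^ 2 * residSq k (betaHat c dd mu x y n) c dd mu x y n * denom k c mu z x y n
        + (f k n * (S c x y n - mu) ^ 2 * betaHat c dd mu x y n
          - z ^ 2 * (∑ i ∈ Finset.range n,
            (s c y y n i - gyy k c dd y n) * (s c x y n i - gxy k c mu x y n))
          - denom k c mu z x y n * betaHat c dd mu x y n) ^ 2 := by
  have h := residSq_eq (k := k) (c := c) (dd := dd) (mu := mu) (x := x) (y := y) (n := n)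
    (betaHat c dd mu x y n)
  rw [denom, h, ← discriminant_eq, ← h, residSq, D]
  simp only [resid]
  ring

lemma D_nonneg (hden : 0 < denom k c mu z x y n) : 0 ≤ D k c dd mu z x y n := by
  have h : 0 ≤ D k c dd mu z x y n / 4 := by
    rw [D_div_four]
    have := residSq_nonneg (k := k) (b := betaHat c dd mu x y n) (c := c) (dd := dd) (mu := mu)
      (x := x) (y := y) (n := n)
    positivity
  linarith

lemma B_one_lt_B_two (hz : 0 < z) (hden : 0 < denom k c mu z x y n)
    (hV : 0 < residSq k (betaHat c dd mu x y n) c dd mu x y n) :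
    B k 1 c dd mu z x y n < B k 2 c dd mu z x y n := by
  have hD : 0 < √(D k c dd mu z x y n / 4) := by
    rw [Real.sqrt_pos, D_div_four]
    positivity
  refine div_lt_div_of_pos_right ?_ hden
  linarith

lemma f_pos (hn : 2 ≤ n) : 0 < f k n := by
  have : (2 : ℝ) ≤ n := by exact_mod_cast hn
  cases k
  · simp only [f]; nlinarith
  · simp only [f]; positivity

lemma mem_interval_iff (hn : n ≠ 0) (hS : S c x y n - mu ≠ 0) (hden : 0 < denom k c mu z x y n) :
    b ∈ interval k c dd mu z x y n ↔
      f k n * mean (u b c dd mu x y n) n ^ 2 ≤ z ^ 2 * residSq k b c dd mu x y n := by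
  have hD : 0 ≤ D k c dd mu z x y n / 4 := div_nonneg (D_nonneg hden) (by norm_num)
  rw [← mul_betaHat_sub hn hS, mul_pow, ← mul_assoc, residSq_eq,
    ← mem_Icc_iff_quadratic_le hden (Real.sqrt_nonneg _) ((Real.sq_sqrt hD).trans ?_)]
  · simp only [interval, B, denom]
    norm_num [sub_eq_add_neg]
  · rw [D_div_four, discriminant_eq, residSq_eq, denom]

lemma mem_pivotSet_iff (hn : 2 ≤ n) (hS : S c x y n - mu ≠ 0) (hz : 0 ≤ z) :
    b ∈ pivotSet k c dd mu z x y n ↔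
      f k n * mean (u b c dd mu x y n) n ^ 2 ≤ z ^ 2 * residSq k b c dd mu x y n := by
  have hn0 : n ≠ 0 := by omega
  cases k
  · have hn1 : (0 : ℝ) < n - 1 := by
      have : (2 : ℝ) ≤ n := by exact_mod_cast hn
      linarith
    have hV := residSq_nonneg (k := .studentized) (b := b) (c := c) (dd := dd) (mu := mu) (x := x)
      (y := y) (n := n)
    simp only [pivotSet, Set.mem_ofPred_eq, mul_assoc, mul_betaHat_sub hn0 hS,
      ← resid_studentized hn0, f, ← residSq.eq_1]
    rw [← sq_le_sq₀ (abs_nonneg _) (by positivity), sq_abs, mul_pow, mul_pow,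
      Real.sq_sqrt n.cast_nonneg, Real.sq_sqrt (by positivity), ← mul_div_assoc, le_div_iff₀ hn1]
    ring_nf
  · simp only [pivotSet, Set.mem_ofPred_eq, mul_assoc, mul_betaHat_sub hn0 hS, f]
    rw [← sq_le_sq₀ (abs_nonneg _) (by positivity), sq_abs, mul_pow, mul_pow,
      Real.sq_sqrt (Finset.sum_nonneg fun _ _ => sq_nonneg _)]
    rfl

lemma interval_eq_pivotSet (hn : 2 ≤ n) (hS : S c x y n - mu ≠ 0) (hz : 0 ≤ z)
    (hden : 0 < denom k c mu z x y n) :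
    interval k c dd mu z x y n = pivotSet k c dd mu z x y n :=
  Set.ext fun _ => by rw [mem_interval_iff (by omega) hS hden, mem_pivotSet_iff hn hS hz]

lemma mem_interval_iff_pivot_mem_Icc (hn : 2 ≤ n) (hS : S c x y n - mu ≠ 0) (hz : 0 ≤ z)
    (hden : 0 < denom k c mu z x y n) (hV : 0 < residSq k b c dd mu x y n) :
    b ∈ interval k c dd mu z x y n ↔ pivot k b c dd mu x y n ∈ Set.Icc (-z) z := by
  rw [mem_interval_iff (by omega) hS hden, Set.mem_Icc, ← abs_le, ← sq_le_sq₀ (abs_nonneg _) hz,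
    sq_abs, pivot, div_pow, mul_pow, Real.sq_sqrt (f_pos hn).le, Real.sq_sqrt hV.le,
    div_le_iff₀ hV]

lemma intervalDefined_of_denom_pos (hβ : BetaHatDefined c dd mu x y n)
    (hden : 0 < denom k c mu z x y n) : IntervalDefined k c dd mu z x y n :=
  ⟨hβ, D_nonneg hden, hden.ne'⟩

end Statistic

section Limits

variable {v w : ℕ → ℝ} {a b c : ℝ}

lemma tendsto_div_succ_of_tendsto_mean (hv : Tendsto (mean v) atTop (𝓝 a)) :
    Tendsto (fun n : ℕ => v n / ((n : ℝ) + 1)) atTop (𝓝 0) := by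
  have h : Tendsto (fun n : ℕ => mean v (n + 1) - mean v n * ((n : ℝ) / ((n : ℝ) + 1)))
      atTop (𝓝 (a - a * 1)) :=
    ((tendsto_add_atTop_iff_nat 1).2 hv).sub (hv.mul (tendsto_natCast_div_add_atTop (1 : ℝ)))
  rw [mul_one, sub_self] at h
  refine h.congr fun n => ?_
  rw [mul_div_assoc', mul_comm (mean v n), ← sum_range_eq_mul_mean, mean, Finset.sum_range_succ]
  push_cast
  ring

lemma eventually_forall_lt_le_mul (hv : Tendsto (mean v) atTop (𝓝 a)) {e : ℝ} (he : 0 < e) :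
    ∀ᶠ n : ℕ in atTop, ∀ i < n, v i ≤ e * n := by
  obtain ⟨N, hN⟩ := eventually_atTop.1
    ((tendsto_div_succ_of_tendsto_mean hv).eventually (gt_mem_nhds he))
  have initial : ∀ᶠ n : ℕ in atTop, ∀ i ∈ Finset.range N, v i ≤ e * n := by
    rw [Filter.eventually_all_finset]
    exact fun i _ =>
      (tendsto_natCast_atTop_atTop.const_mul_atTop he).eventually (eventually_ge_atTop _)
  filter_upwards [initial] with n hn i hi
  by_cases hiN : i < N
  · exact hn i (Finset.mem_range.2 hiN)
  · have hvi := hN i (not_lt.1 hiN)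
    rw [div_lt_iff₀ (by positivity)] at hvi
    have hin : (i : ℝ) + 1 ≤ n := by exact_mod_cast hi
    nlinarith

lemma tendsto_mean_mul_div (hv0 : ∀ i, 0 ≤ v i) (hw0 : ∀ i, 0 ≤ w i)
    (hv : Tendsto (mean v) atTop (𝓝 a)) (hw : Tendsto (mean w) atTop (𝓝 b)) :
    Tendsto (fun n : ℕ => mean (fun i => v i * w i) n / n) atTop (𝓝 0) := by
  refine tendsto_order.2 ⟨fun e he => .of_forall fun n => he.trans_le ?_, fun e he => ?_⟩
  · exact div_nonneg (mean_nonneg fun i => mul_nonneg (hv0 i) (hw0 i)) n.cast_nonneg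
  · have hb : 0 < |b| + 1 := by positivity
    filter_upwards [eventually_forall_lt_le_mul hv (div_pos he hb), eventually_gt_atTop 0,
      hw.eventually (gt_mem_nhds ((le_abs_self b).trans_lt (lt_add_one _)))] with n hvn hn hwn
    have hn0 : (0 : ℝ) < n := by exact_mod_cast hn
    rw [div_lt_iff₀ hn0]
    calc mean (fun i => v i * w i) n ≤ e / (|b| + 1) * n * mean w n := by
          rw [mean, mean, mul_div_assoc', Finset.mul_sum]
          gcongr with i hi
          · exact hw0 i
          · exact hvn i (Finset.mem_range.1 hi)
      _ < e / (|b| + 1) * n * (|b| + 1) := by gcongr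
      _ = e * n := by field_simp

lemma tendsto_mean_add_sq {p q : ℕ → ℕ → ℝ} {L : ℝ}
    (hp : Tendsto (fun n => mean (fun i => p n i ^ 2) n) atTop (𝓝 L))
    (hq : Tendsto (fun n => mean (fun i => q n i ^ 2) n) atTop (𝓝 0)) :
    Tendsto (fun n => mean (fun i => (p n i + q n i) ^ 2) n) atTop (𝓝 L) := by
  have cross : Tendsto (fun n => mean (fun i => p n i * q n i) n) atTop (𝓝 0) := by
    have hpq := hp.mul hq
    rw [mul_zero] at hpq
    have := (squeeze_zero (fun n => sq_nonneg _) (fun n => mean_mul_sq_le (p n) (q n) n) hpq).sqrt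
    rw [tendsto_zero_iff_abs_tendsto_zero]
    simpa [Real.sqrt_sq_eq_abs, Function.comp_def] using this
  have hsum := (hp.add (cross.const_mul 2)).add hq
  rw [mul_zero, add_zero, add_zero] at hsum
  refine hsum.congr fun n => ?_
  rw [← mean_const_mul, ← mean_add, ← mean_add]
  congr 1
  ext i
  ring

lemma tendsto_mean_s_sub_mul_sq (hv : Tendsto (mean v) atTop (𝓝 a))
    (hw : Tendsto (mean w) atTop (𝓝 b)) {A B : ℝ}
    (hv2 : Tendsto (mean fun i => (v i - c * a) ^ 2) atTop (𝓝 A))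
    (hw2 : Tendsto (mean fun i => (w i - c * b) ^ 2) atTop (𝓝 B)) :
    Tendsto (fun n => mean (fun i => (s c v w n i - (v i - c * a) * (w i - c * b)) ^ 2) n)
      atTop (𝓝 0) := by
  have hp : Tendsto (fun n => c * (mean v n - a)) atTop (𝓝 0) := by
    simpa using (hv.sub_const a).const_mul c
  have hq : Tendsto (fun n => c * (mean w n - b)) atTop (𝓝 0) := by
    simpa using (hw.sub_const b).const_mul c
  have h_pw : Tendsto (fun n => mean (fun i => (-(c * (mean v n - a)) * (w i - c * b)) ^ 2) n)
      atTop (𝓝 0) := by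
    simpa [mul_pow, mean_const_mul] using (hp.pow 2).mul hw2
  have h_qv : Tendsto (fun n => mean (fun i => (-(c * (mean w n - b)) * (v i - c * a)) ^ 2) n)
      atTop (𝓝 0) := by
    simpa [mul_pow, mean_const_mul] using (hq.pow 2).mul hv2
  have h_pq : Tendsto
      (fun n => mean (fun _ => (c * (mean v n - a) * (c * (mean w n - b))) ^ 2) n)
      atTop (𝓝 0) := by
    have h := (hp.mul hq).pow 2
    rw [mul_zero, zero_pow two_ne_zero] at h
    refine h.congr' ?_
    filter_upwards [eventually_ne_atTop 0] with n hn
    rw [mean_const _ hn]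
  refine (tendsto_mean_add_sq (tendsto_mean_add_sq h_pw h_qv) h_pq).congr fun n => ?_
  congr 1
  ext i
  rw [s_eq_sub_mul_sub c a b]
  ring

lemma tendsto_mean_s_sub_sq (hv : Tendsto (mean v) atTop (𝓝 a))
    (hw : Tendsto (mean w) atTop (𝓝 b)) {A B L κ : ℝ}
    (hv2 : Tendsto (mean fun i => (v i - c * a) ^ 2) atTop (𝓝 A))
    (hw2 : Tendsto (mean fun i => (w i - c * b) ^ 2) atTop (𝓝 B))
    (hL : Tendsto (mean fun i => ((v i - c * a) * (w i - c * b) - κ) ^ 2) atTop (𝓝 L)) :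
    Tendsto (fun n => mean (fun i => (s c v w n i - κ) ^ 2) n) atTop (𝓝 L) := by
  refine (tendsto_mean_add_sq hL (tendsto_mean_s_sub_mul_sq hv hw hv2 hw2)).congr fun n => ?_
  congr 1
  ext i
  ring

lemma tendsto_mean_s_sub_sq_div (hv : Tendsto (mean v) atTop (𝓝 a))
    (hw : Tendsto (mean w) atTop (𝓝 b)) {A B κ : ℝ} {g : ℕ → ℝ}
    (hv2 : Tendsto (mean fun i => (v i - c * a) ^ 2) atTop (𝓝 A))
    (hw2 : Tendsto (mean fun i => (w i - c * b) ^ 2) atTop (𝓝 B))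
    (hg : Tendsto g atTop (𝓝 κ)) :
    Tendsto (fun n : ℕ => mean (fun i => (s c v w n i - g n) ^ 2) n / n) atTop (𝓝 0) := by
  have inv_tendsto : Tendsto (fun n : ℕ => (n : ℝ)⁻¹) atTop (𝓝 0) :=
    tendsto_inv_atTop_nhds_zero_nat
  have h_main := tendsto_mean_mul_div (fun i => sq_nonneg _) (fun i => sq_nonneg _) hv2 hw2
  have h_diff := (tendsto_mean_s_sub_mul_sq hv hw hv2 hw2).mul inv_tendsto
  have h_g := (hg.pow 2).mul inv_tendsto
  have bound := ((h_diff.add h_main).add h_g).const_mul 3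
  simp only [mul_zero, add_zero] at bound
  refine squeeze_zero' (.of_forall fun n => div_nonneg (mean_nonneg fun i => sq_nonneg _)
    n.cast_nonneg) ?_ bound
  filter_upwards [eventually_ne_atTop 0] with n hn
  rw [← div_eq_mul_inv, ← div_eq_mul_inv, ← add_div, ← add_div, mul_div_assoc']
  gcongr
  rw [← mean_const (g n ^ 2) hn, ← mean_add, ← mean_add, ← mean_const_mul]
  refine mean_mono (fun i => ?_) n
  set m := (v i - c * a) * (w i - c * b)
  rw [← mul_pow]
  nlinarith [sq_nonneg (s c v w n i - 2 * m), sq_nonneg (s c v w n i - m + g n),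
    sq_nonneg (m + g n)]

end Limits

section StatisticLimits

variable {c dd mu z A B κ L a b β : ℝ} {x y : ℕ → ℝ}

lemma tendsto_f_div (k : Kind) : Tendsto (fun n : ℕ => f k n / (n : ℝ) ^ 2) atTop (𝓝 1) := by
  cases k
  · have h : Tendsto (fun n : ℕ => 1 - (n : ℝ)⁻¹) atTop (𝓝 (1 - 0)) :=
      tendsto_const_nhds.sub tendsto_inv_atTop_nhds_zero_nat
    rw [sub_zero] at h
    refine h.congr' ?_
    filter_upwards [eventually_ne_atTop 0] with n hn
    simp only [f]
    field_simp
  · refine tendsto_const_nhds.congr' ?_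
    filter_upwards [eventually_ne_atTop 0] with n hn
    simp only [f]
    field_simp

lemma exists_tendsto_gxy (k : Kind) (mu : ℝ) (hS : Tendsto (S c x y) atTop (𝓝 κ)) :
    ∃ g, Tendsto (gxy k c mu x y) atTop (𝓝 g) :=
  match k with
  | .studentized => ⟨κ, hS⟩
  | .selfNormalized => ⟨mu, tendsto_const_nhds⟩

lemma eventually_denom_pos (k : Kind) (z : ℝ) (hx : Tendsto (mean x) atTop (𝓝 a))
    (hy : Tendsto (mean y) atTop (𝓝 b))
    (hx2 : Tendsto (mean fun i => (x i - c * a) ^ 2) atTop (𝓝 A))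
    (hy2 : Tendsto (mean fun i => (y i - c * b) ^ 2) atTop (𝓝 B))
    (hS : Tendsto (S c x y) atTop (𝓝 κ)) (hκ : κ - mu ≠ 0) :
    ∀ᶠ n in atTop, 0 < denom k c mu z x y n := by
  obtain ⟨g, hg⟩ := exists_tendsto_gxy k mu hS
  have h : Tendsto (fun n : ℕ => denom k c mu z x y n / (n : ℝ) ^ 2) atTop
      (𝓝 (1 * (κ - mu) ^ 2 - z ^ 2 * 0)) := by
    refine (((tendsto_f_div k).mul ((hS.sub_const mu).pow 2)).sub
      ((tendsto_mean_s_sub_sq_div hx hy hx2 hy2 hg).const_mul (z ^ 2))).congr fun n => ?_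
    rw [denom, mean]
    ring
  have hpos : 0 < 1 * (κ - mu) ^ 2 - z ^ 2 * 0 := by
    rw [one_mul, mul_zero, sub_zero]
    positivity
  filter_upwards [h.eventually (lt_mem_nhds hpos), eventually_gt_atTop 0] with n hn hn0
  exact (div_pos_iff_of_pos_right (by positivity)).1 hn

lemma tendsto_betaHat (hxy : Tendsto (S c x y) atTop (𝓝 κ)) (hyy : Tendsto (S c y y) atTop (𝓝 L))
    (hκ : κ - mu ≠ 0) (hβ : L - dd = β * (κ - mu)) :
    Tendsto (betaHat c dd mu x y) atTop (𝓝 β) := by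
  have h := (hyy.sub_const dd).div (hxy.sub_const mu) hκ
  rwa [hβ, mul_div_cancel_right₀ _ hκ] at h

lemma tendsto_s (hx : Tendsto (mean x) atTop (𝓝 a)) (hy : Tendsto (mean y) atTop (𝓝 b)) (c : ℝ)
    (i : ℕ) : Tendsto (fun n => s c x y n i) atTop (𝓝 ((x i - c * a) * (y i - c * b))) :=
  (tendsto_const_nhds.sub (hx.const_mul c)).mul (tendsto_const_nhds.sub (hy.const_mul c))

lemma exists_ne_zero_of_tendsto_mean_sq {v : ℕ → ℝ}
    (hv : Tendsto (mean fun i => v i ^ 2) atTop (𝓝 L)) (hL : L ≠ 0) : ∃ i, v i ≠ 0 := by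
  by_contra! h
  refine hL (tendsto_nhds_unique hv (tendsto_const_nhds.congr fun n => ?_))
  simp [h, mean]

lemma eventually_residSq_betaHat_pos (k : Kind) (hx : Tendsto (mean x) atTop (𝓝 a))
    (hy : Tendsto (mean y) atTop (𝓝 b)) (hS : ∀ᶠ n in atTop, S c x y n - mu ≠ 0)
    (hβ : Tendsto (betaHat c dd mu x y) atTop (𝓝 β))
    (hL : Tendsto (mean fun i => ((y i - c * b) * (y i - β * x i - c * (b - β * a))
      - (dd - β * mu)) ^ 2) atTop (𝓝 L)) (hL0 : L ≠ 0) :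
    ∀ᶠ n in atTop, 0 < residSq k (betaHat c dd mu x y n) c dd mu x y n := by
  obtain ⟨i, hi⟩ := exists_ne_zero_of_tendsto_mean_sq hL hL0
  have hu : Tendsto (fun n => u (betaHat c dd mu x y n) c dd mu x y n i) atTop
      (𝓝 ((y i - c * b) * (y i - β * x i - c * (b - β * a)) - (dd - β * mu))) := by
    have h := ((tendsto_s hy hy c i).sub_const dd).sub (hβ.mul ((tendsto_s hx hy c i).sub_const mu))
    convert! h using 2
    ring
  filter_upwards [hu.eventually_ne hi, eventually_gt_atTop i, hS] with n hun hin hSn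
  refine Finset.sum_pos' (fun _ _ => sq_nonneg _) ⟨i, Finset.mem_range.2 hin, ?_⟩
  rw [resid_betaHat (by omega) hSn]
  positivity

lemma tendsto_residSq_div (k : Kind) (b : ℝ)
    (hS : Tendsto (S c y fun i => y i - b * x i) atTop (𝓝 (dd - b * mu)))
    (hL : Tendsto (fun n => mean (fun i => (s c y (fun i => y i - b * x i) n i
      - (dd - b * mu)) ^ 2) n) atTop (𝓝 L)) :
    Tendsto (fun n : ℕ => residSq k b c dd mu x y n / n) atTop (𝓝 L) := by
  simp only [← u_eq_s_sub] at hL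
  cases k
  · have hm := (hS.sub_const (dd - b * mu)).pow 2
    rw [sub_self, zero_pow two_ne_zero] at hm
    refine (sub_zero L ▸ hL.sub hm).congr' ?_
    filter_upwards [eventually_ne_atTop 0] with n hn
    have expand (i : ℕ) : (u b c dd mu x y n i - mean (u b c dd mu x y n) n) ^ 2 =
        u b c dd mu x y n i ^ 2 - 2 * mean (u b c dd mu x y n) n * u b c dd mu x y n i
          + mean (u b c dd mu x y n) n ^ 2 := by ring
    simp only [residSq, resid_studentized hn, ← mean.eq_1]
    rw [funext expand, mean_add, mean_sub, mean_const_mul, mean_const _ hn, ← mean_u_eq_S_sub hn]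
    ring
  · exact hL

end StatisticLimits

section Measurability

variable {Ω : Type*} [MeasurableSpace Ω] {x y : Ω → ℕ → ℝ}

@[fun_prop]
lemma measurable_mean (hx : Measurable x) (n : ℕ) : Measurable fun ω => mean (x ω) n := by
  unfold mean
  fun_prop

@[fun_prop]
lemma measurable_s (c : ℝ) (hx : Measurable x) (hy : Measurable y) (n : ℕ) :
    Measurable fun ω => s c (x ω) (y ω) n :=
  measurable_pi_iff.2 fun i => by
    unfold s
    fun_prop

@[fun_prop]
lemma measurable_S (c : ℝ) (hx : Measurable x) (hy : Measurable y) (n : ℕ) :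
    Measurable fun ω => S c (x ω) (y ω) n := by
  unfold S
  fun_prop

@[fun_prop]
lemma measurable_gyy (k : Kind) (c dd : ℝ) (hy : Measurable y) (n : ℕ) :
    Measurable fun ω => gyy k c dd (y ω) n :=
  match k with
  | .studentized => measurable_S c hy hy n
  | .selfNormalized => measurable_const

@[fun_prop]
lemma measurable_gxy (k : Kind) (c mu : ℝ) (hx : Measurable x) (hy : Measurable y) (n : ℕ) :
    Measurable fun ω => gxy k c mu (x ω) (y ω) n :=
  match k with
  | .studentized => measurable_S c hx hy n
  | .selfNormalized => measurable_const

@[fun_prop]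
lemma measurable_betaHat (c dd mu : ℝ) (hx : Measurable x) (hy : Measurable y) (n : ℕ) :
    Measurable fun ω => betaHat c dd mu (x ω) (y ω) n := by
  unfold betaHat
  fun_prop

@[fun_prop]
lemma measurable_residSq (k : Kind) (b c dd mu : ℝ) (hx : Measurable x) (hy : Measurable y)
    (n : ℕ) : Measurable fun ω => residSq k b c dd mu (x ω) (y ω) n := by
  unfold residSq resid
  fun_prop

@[fun_prop]
lemma measurable_D (k : Kind) (c dd mu z : ℝ) (hx : Measurable x) (hy : Measurable y) (n : ℕ) :
    Measurable fun ω => D k c dd mu z (x ω) (y ω) n := by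
  unfold D
  fun_prop

@[fun_prop]
lemma measurable_denom (k : Kind) (c mu z : ℝ) (hx : Measurable x) (hy : Measurable y) (n : ℕ) :
    Measurable fun ω => denom k c mu z (x ω) (y ω) n := by
  unfold denom
  fun_prop

@[fun_prop]
lemma measurable_B (k : Kind) (l : ℕ) (c dd mu z : ℝ) (hx : Measurable x) (hy : Measurable y)
    (n : ℕ) : Measurable fun ω => B k l c dd mu z (x ω) (y ω) n := by
  unfold B
  fun_prop

lemma measurableSet_intervalDefined (k : Kind) (c dd mu z : ℝ) (hx : Measurable x)
    (hy : Measurable y) (n : ℕ) :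
    MeasurableSet {ω | IntervalDefined k c dd mu z (x ω) (y ω) n} := by
  unfold IntervalDefined BetaHatDefined
  measurability

lemma measurableSet_mem_interval (k : Kind) (b c dd mu z : ℝ) (hx : Measurable x)
    (hy : Measurable y) (n : ℕ) :
    MeasurableSet {ω | b ∈ interval k c dd mu z (x ω) (y ω) n} :=
  (measurableSet_le (measurable_B k 1 c dd mu z hx hy n) measurable_const).inter
    (measurableSet_le measurable_const (measurable_B k 2 c dd mu z hx hy n))

end Measurability

section Probability

variable {Ω : Type*} [MeasurableSpace Ω] {P : Measure Ω}

lemma iIndepFun_prodMk {ι : Type*} {E F : ι → Type*} [∀ i, MeasurableSpace (E i)]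
    [∀ i, MeasurableSpace (F i)] {X : ∀ i, Ω → E i} {Y : ∀ i, Ω → F i}
    (mX : ∀ i, Measurable (X i)) (mY : ∀ i, Measurable (Y i)) (hX : iIndepFun X P)
    (hY : iIndepFun Y P) (hXY : IndepFun (fun ω i => X i ω) (fun ω i => Y i ω) P) :
    iIndepFun (fun i ω => (X i ω, Y i ω)) P := by
  have := hX.isProbabilityMeasure
  let π : ι → Set (Set Ω) := fun i =>
    (fun t => (fun ω => (X i ω, Y i ω)) ⁻¹' t) ''
      (Set.image2 (· ×ˢ ·) {a | MeasurableSet a} {b | MeasurableSet b})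
  have hπ (i : ι) : MeasurableSpace.comap (fun ω => (X i ω, Y i ω)) inferInstance =
      MeasurableSpace.generateFrom (π i) := by
    rw [← generateFrom_prod, MeasurableSpace.comap_generateFrom]
  refine iIndepSets.iIndep (fun i => ((mX i).prodMk (mY i)).comap_le) π
    (fun i => isPiSystem_prod.comap _) hπ ((iIndepSets_iff _ _).2 fun I t ht => ?_)
  have rectangle : ∀ i ∈ I, ∃ a b, MeasurableSet a ∧ MeasurableSet b ∧
      t i = X i ⁻¹' a ∩ Y i ⁻¹' b := fun i hi => by
    obtain ⟨_, ⟨a, ha, b, hb, rfl⟩, h⟩ := ht i hi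
    exact ⟨a, b, ha, hb, h.symm⟩
  choose! a b ha hb ht using rectangle
  calc P (⋂ i ∈ I, t i)
      = P ((fun ω i => X i ω) ⁻¹' (⋂ i ∈ I, (· i) ⁻¹' a i) ∩
          (fun ω i => Y i ω) ⁻¹' (⋂ i ∈ I, (· i) ⁻¹' b i)) := by
        rw [Set.iInter₂_congr ht]
        simp only [Set.preimage_iInter, Set.iInter_inter_distrib]
        rfl
    _ = P (⋂ i ∈ I, X i ⁻¹' a i) * P (⋂ i ∈ I, Y i ⁻¹' b i) := by
        rw [hXY.measure_inter_preimage_eq_mul _ _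
          (Finset.measurableSet_biInter _ fun i hi => measurable_pi_apply i (ha i hi))
          (Finset.measurableSet_biInter _ fun i hi => measurable_pi_apply i (hb i hi))]
        simp only [Set.preimage_iInter]
        rfl
    _ = ∏ i ∈ I, P (t i) := by
        rw [hX.measure_inter_preimage_eq_mul I ha, hY.measure_inter_preimage_eq_mul I hb,
          ← Finset.prod_mul_distrib]
        refine Finset.prod_congr rfl fun i hi => ?_
        have hi' : IndepFun (X i) (Y i) P :=
          hXY.comp (measurable_pi_apply i) (measurable_pi_apply i)
        rw [ht i hi, hi'.measure_inter_preimage_eq_mul _ _ (ha i hi) (hb i hi)]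

lemma IID.prodMk {E F : Type*} [MeasurableSpace E] [MeasurableSpace F] {X : ℕ → Ω → E}
    {Y : ℕ → Ω → F} (hX : IID P X) (hY : IID P Y)
    (hXY : IndepFun (fun ω i => X i ω) (fun ω i => Y i ω) P) :
    IID P (fun i ω => (X i ω, Y i ω)) where
  measurable i := (hX.measurable i).prodMk (hY.measurable i)
  indep := iIndepFun_prodMk hX.measurable hY.measurable hX.indep hY.indep hXY
  ident i := by
    have := hX.indep.isProbabilityMeasure
    have h (j : ℕ) : IndepFun (X j) (Y j) P :=
      hXY.comp (measurable_pi_apply j) (measurable_pi_apply j)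
    exact (hX.ident i).prodMk (hY.ident i) (h i) (h 0)

lemma IID.comp {E F : Type*} [MeasurableSpace E] [MeasurableSpace F] {X : ℕ → Ω → E}
    (hX : IID P X) {g : E → F} (hg : Measurable g) : IID P (fun i ω => g (X i ω)) where
  measurable i := hg.comp (hX.measurable i)
  indep := hX.indep.comp (fun _ => g) fun _ => hg
  ident i := (hX.ident i).comp hg

lemma IID.ae_tendsto_mean {X : ℕ → Ω → ℝ} (hX : IID P X) (hint : Integrable (X 0) P) :
    ∀ᵐ ω ∂P, Tendsto (mean fun i => X i ω) atTop (𝓝 (∫ ω, X 0 ω ∂P)) :=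
  strong_law_ae_real X hint (fun _ _ hij => hX.indep.indepFun hij) hX.ident

variable [IsProbabilityMeasure P]

lemma IID.tendstoInDistribution_sqrt_mul_mean_sub {X : ℕ → Ω → ℝ} (hX : IID P X)
    (h2 : MemLp (X 0) 2 P) :
    TendstoInDistribution
      (fun (n : ℕ) ω => √n * (mean (fun i => X i ω) n - ∫ ω, X 0 ω ∂P)) atTop
      (fun t : ℝ => √(Var[X 0; P]) * t) (fun _ => P) (gaussianReal 0 1) := by
  have hlaw : HasLaw (fun t : ℝ => √(Var[X 0; P]) * t)
      (gaussianReal 0 (Var[X 0; P]).toNNReal) (gaussianReal 0 1) := by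
    refine ⟨by fun_prop, ?_⟩
    rw [gaussianReal_map_const_mul, mul_zero, mul_one]
    congr 1
    ext
    simp [Real.sq_sqrt (variance_nonneg _ _), Real.coe_toNNReal _ (variance_nonneg _ _)]
  convert! tendstoInDistribution_inv_sqrt_mul_sum_sub hlaw h2 hX.indep hX.ident using 3 with n ω
  rw [sum_range_eq_mul_mean, ← mul_sub, ← mul_assoc]
  congr 1
  rw [inv_mul_eq_div, Real.div_sqrt]

lemma IID.inDAN {X : ℕ → Ω → ℝ} (hX : IID P X) (h2 : MemLp (X 0) 2 P) (hvar : 0 < Var[X 0; P]) :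
    IIDInDAN P X := by
  have hσ := Real.sqrt_pos.2 hvar
  refine ⟨hX, fun n => n * ∫ ω, X 0 ω ∂P, fun n => if n = 0 then 1 else √n * √(Var[X 0; P]),
    fun n => ?_, ?_⟩
  · dsimp only
    split_ifs with hn
    · exact one_pos
    · have : (0 : ℝ) < n := by positivity
      positivity
  · convert! (hX.tendstoInDistribution_sqrt_mul_mean_sub h2).continuous_comp
      (g := fun t : ℝ => (√(Var[X 0; P]))⁻¹ * t) (by fun_prop) using 3 with n ω t
    · rcases eq_or_ne n 0 with rfl | hn
      · simp
      · have : (0 : ℝ) < n := by positivity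
        simp only [sum_range_eq_mul_mean, if_neg hn, Function.comp_apply]
        field_simp
        rw [Real.sq_sqrt this.le, mul_comm]
    · ext t
      simp [hσ.ne']

lemma tendsto_measureReal_preimage {Ω' : Type*} [MeasurableSpace Ω']
    {Q : Measure Ω'} [IsProbabilityMeasure Q] {X : ℕ → Ω → ℝ} {Z : Ω' → ℝ}
    (h : TendstoInDistribution X atTop Z (fun _ => P) Q) {A : Set ℝ} (hA : MeasurableSet A)
    (hfr : Q (Z ⁻¹' frontier A) = 0) :
    Tendsto (fun n => P.real (X n ⁻¹' A)) atTop (𝓝 (Q.real (Z ⁻¹' A))) := by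
  have hlaw := ProbabilityMeasure.tendsto_measure_of_null_frontier_of_tendsto' h.tendsto (E := A)
    (by
      rw [ProbabilityMeasure.coe_mk, Measure.map_apply_of_aemeasurable h.aemeasurable_limit
        isClosed_frontier.measurableSet]
      exact hfr)
  simp only [ProbabilityMeasure.coe_mk] at hlaw
  rw [Measure.map_apply_of_aemeasurable h.aemeasurable_limit hA] at hlaw
  refine ((ENNReal.tendsto_toReal (measure_ne_top _ _)).comp hlaw).congr fun n => ?_
  rw [Function.comp_apply, Measure.map_apply_of_aemeasurable (h.forall_aemeasurable n) hA,
    Measure.real]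

lemma tendstoInMeasure_zero_of_tendstoInDistribution {Ω' : Type*}
    [MeasurableSpace Ω'] {Q : Measure Ω'} [IsProbabilityMeasure Q] {X : ℕ → Ω → ℝ}
    (h : TendstoInDistribution X atTop (fun _ : Ω' => (0 : ℝ)) (fun _ => P) Q) :
    TendstoInMeasure P X atTop (fun _ => 0) := by
  rw [tendstoInMeasure_iff_measureReal_norm]
  intro e he
  have hcl : IsClosed {t : ℝ | e ≤ ‖t‖} := isClosed_le continuous_const continuous_norm
  have h0 : (0 : ℝ) ∉ {t : ℝ | e ≤ ‖t‖} := by simpa using he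
  have hlim := tendsto_measureReal_preimage h hcl.measurableSet (by
    rw [Set.preimage_const_of_notMem fun h => h0 (hcl.frontier_subset h), measure_empty])
  rw [Set.preimage_const_of_notMem h0, measureReal_empty] at hlim
  simpa using hlim

lemma tendstoInDistribution_mul_of_ae_tendsto {Ω' : Type*} [MeasurableSpace Ω'] {Q : Measure Ω'}
    [IsProbabilityMeasure Q] {X Y : ℕ → Ω → ℝ} {Z : Ω' → ℝ} {a : ℝ}
    (hX : TendstoInDistribution X atTop Z (fun _ => P) Q) (mY : ∀ n, Measurable (Y n))
    (hY : ∀ᵐ ω ∂P, Tendsto (fun n => Y n ω) atTop (𝓝 a)) :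
    TendstoInDistribution (fun n ω => X n ω * Y n ω) atTop (fun ω => Z ω * a) (fun _ => P) Q :=
  hX.continuous_comp_prodMk_of_tendstoInMeasure_const (g := fun p : ℝ × ℝ => p.1 * p.2)
    (by fun_prop) (tendstoInMeasure_of_tendsto_ae (fun n => (mY n).aestronglyMeasurable) hY)
    fun n => (mY n).aemeasurable

lemma tendsto_measureReal_one_of_ae_eventually {A : ℕ → Set Ω}
    (h : ∀ᵐ ω ∂P, ∀ᶠ n in atTop, ω ∈ A n) : Tendsto (fun n => P.real (A n)) atTop (𝓝 1) := by
  have hmono : Monotone fun N => ⋂ n ≥ N, A n := fun _ _ hNM =>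
    Set.biInter_subset_biInter_left fun _ hn => hNM.trans hn
  have hunion : P (⋃ N, ⋂ n ≥ N, A n) = 1 := by
    rw [← measure_univ (μ := P)]
    refine measure_congr (eventuallyEq_univ.2 ?_)
    filter_upwards [h] with ω hω
    simpa [eventually_atTop] using hω
  have hlim : Tendsto (fun N => P (⋂ n ≥ N, A n)) atTop (𝓝 1) :=
    hunion ▸ tendsto_measure_iUnion_atTop hmono
  have hA : Tendsto (fun n => P (A n)) atTop (𝓝 1) :=
    tendsto_of_tendsto_of_tendsto_of_le_of_le hlim tendsto_const_nhds
      (fun N => measure_mono (Set.iInter₂_subset N le_rfl)) fun _ => prob_le_one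
  exact (ENNReal.tendsto_toReal ENNReal.one_ne_top).comp hA

lemma tendsto_measureReal_congr {A E : ℕ → Set Ω} {p : ℝ} (mA : ∀ n, NullMeasurableSet (A n) P)
    (mE : ∀ n, NullMeasurableSet (E n) P) (hE : Tendsto (fun n => P.real (E n)) atTop (𝓝 p))
    (h : ∀ᵐ ω ∂P, ∀ᶠ n in atTop, ω ∈ A n ↔ ω ∈ E n) :
    Tendsto (fun n => P.real (A n)) atTop (𝓝 p) := by
  have hsymm : Tendsto (fun n => P.real (symmDiff (A n) (E n))) atTop (𝓝 0) := by
    have hone : Tendsto (fun n => P.real (symmDiff (A n) (E n))ᶜ) atTop (𝓝 1) := by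
      refine tendsto_measureReal_one_of_ae_eventually ?_
      filter_upwards [h] with ω hω
      filter_upwards [hω] with n hn
      simp only [Set.mem_compl_iff, Set.mem_symmDiff]
      tauto
    rw [← sub_self (1 : ℝ)]
    refine (hone.const_sub 1).congr fun n => ?_
    rw [probReal_compl_eq_one_sub₀ ((mA n).symmDiff (mE n)), sub_sub_cancel]
  have hdiff : Tendsto (fun n => P.real (A n) - P.real (E n)) atTop (𝓝 0) :=
    squeeze_zero_norm (fun n => abs_measureReal_sub_le_measureReal_symmDiff (mA n) (mE n)) hsymm
  simpa using hdiff.add hE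

lemma gaussianReal_real_Iio_neg (z : ℝ) (v : NNReal) :
    (gaussianReal 0 v).real (Set.Iio (-z)) = 1 - cdf (gaussianReal 0 v) z := by
  rw [cdf_eq_real, ← probReal_compl_eq_one_sub measurableSet_Iic]
  conv_lhs => rw [← neg_zero, ← gaussianReal_map_neg]
  rw [map_measureReal_apply measurable_neg measurableSet_Iio]
  congr 1
  ext x
  simp

lemma gaussianReal_real_Icc_neg {z : ℝ} (hz : 0 ≤ z) (v : NNReal) :
    (gaussianReal 0 v).real (Set.Icc (-z) z) = 2 * cdf (gaussianReal 0 v) z - 1 := by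
  have hIio : Set.Iio (-z) ⊆ Set.Iic z := fun x hx => by
    simp only [Set.mem_Iio, Set.mem_Iic] at hx ⊢
    linarith
  have hIcc : Set.Icc (-z) z = Set.Iic z \ Set.Iio (-z) := by
    ext x
    simp [and_comm]
  rw [hIcc, measureReal_sdiff hIio measurableSet_Iio, gaussianReal_real_Iio_neg, cdf_eq_real]
  ring

lemma pos_of_half_lt_cdf_gaussianReal {z : ℝ} {v : NNReal} (hv : v ≠ 0)
    (h : 1 / 2 < cdf (gaussianReal 0 v) z) : 0 < z := by
  by_contra! hz
  have := nullSingletonClass_gaussianReal (μ := 0) hv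
  have hIio : cdf (gaussianReal 0 v) z ≤ 1 - cdf (gaussianReal 0 v) z := by
    rw [← gaussianReal_real_Iio_neg, cdf_eq_real, ← measureReal_congr Iio_ae_eq_Iic]
    exact measureReal_mono (Set.Iio_subset_Iio (by linarith))
  linarith

end Probability

section CentredMul

variable {Ω : Type*} [MeasurableSpace Ω] {P : Measure Ω} {c : ℝ}

/-- The product `(X - c E X) (Y - c E Y)`: the population counterpart of `s c x y n i`, with the
sample means replaced by the expectations. -/
noncomputable def centredMul (P : Measure Ω) (c : ℝ) (X Y : Ω → ℝ) (ω : Ω) : ℝ :=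
  (X ω - c * ∫ ω, X ω ∂P) * (Y ω - c * ∫ ω, Y ω ∂P)

lemma centredMul_sub_const_mul (b : ℝ) {X Y : Ω → ℝ} (hX : Integrable X P) (hY : Integrable Y P) :
    centredMul P c Y (fun ω => Y ω - b * X ω) =
      fun ω => centredMul P c Y Y ω - b * centredMul P c X Y ω := by
  ext ω
  simp only [centredMul]
  rw [integral_sub hY (hX.const_mul b), integral_const_mul]
  ring

variable [IsProbabilityMeasure P]

lemma integrable_centredMul {X Y : Ω → ℝ} (hX : MemLp X 2 P) (hY : MemLp Y 2 P) :
    Integrable (centredMul P c X Y) P :=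
  (hX.sub (memLp_const _)).integrable_mul (hY.sub (memLp_const _))

lemma integral_centredMul (hc : c ^ 2 = c) {X Y : Ω → ℝ} (hX : MemLp X 2 P) (hY : MemLp Y 2 P) :
    ∫ ω, centredMul P c X Y ω ∂P =
      cov[X, Y; P] + (1 - c) * ((∫ ω, X ω ∂P) * ∫ ω, Y ω ∂P) := by
  have hX1 := hX.integrable one_le_two
  have hY1 := hY.integrable one_le_two
  have hXY : Integrable (fun ω => X ω * Y ω) P := hX.integrable_mul hY
  have expand (ω : Ω) : centredMul P c X Y ω =
      X ω * Y ω - (c * ∫ ω, Y ω ∂P) * X ω - (c * ∫ ω, X ω ∂P) * Y ω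
        + c * ((∫ ω, X ω ∂P) * ∫ ω, Y ω ∂P) := by
    rw [centredMul]
    linear_combination ((∫ ω, X ω ∂P) * ∫ ω, Y ω ∂P) * hc
  rw [covariance_eq_sub hX hY, funext expand, integral_add (by fun_prop) (by fun_prop),
    integral_sub (by fun_prop) (by fun_prop), integral_sub hXY (by fun_prop), integral_const_mul,
    integral_const_mul, integral_const, probReal_univ, one_smul]
  simp only [Pi.mul_apply]
  ring

end CentredMul

section SamplePair

variable {Ω : Type*} [MeasurableSpace Ω] {P : Measure Ω} {c : ℝ} {x y : Ω → ℕ → ℝ}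

lemma IID.sub_mul_sub (hxy : IID P fun i ω => (x ω i, y ω i)) (a b : ℝ) :
    IID P fun i ω => (x ω i - a) * (y ω i - b) :=
  hxy.comp (g := fun p => (p.1 - a) * (p.2 - b)) (by fun_prop)

variable [IsProbabilityMeasure P]

lemma IID.ae_tendsto_mean_sub_sq {X : ℕ → Ω → ℝ} (hX : IID P X) (h2 : MemLp (X 0) 2 P) (r : ℝ) :
    ∀ᵐ ω ∂P, Tendsto (mean fun i => (X i ω - r) ^ 2) atTop (𝓝 (∫ ω, (X 0 ω - r) ^ 2 ∂P)) :=
  (hX.comp (g := fun t => (t - r) ^ 2) (by fun_prop)).ae_tendsto_mean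
    (h2.sub (memLp_const r)).integrable_sq

lemma IID.ae_tendsto_S (hxy : IID P fun i ω => (x ω i, y ω i)) (hc : c ^ 2 = c)
    (hx : MemLp (fun ω => x ω 0) 2 P) (hy : MemLp (fun ω => y ω 0) 2 P) :
    ∀ᵐ ω ∂P, Tendsto (S c (x ω) (y ω)) atTop
      (𝓝 (∫ ω, centredMul P c (x · 0) (y · 0) ω ∂P)) := by
  filter_upwards [(hxy.comp measurable_fst).ae_tendsto_mean (hx.integrable one_le_two),
    (hxy.comp measurable_snd).ae_tendsto_mean (hy.integrable one_le_two),
    (hxy.sub_mul_sub _ _).ae_tendsto_mean (integrable_centredMul hx hy)] with ω hxω hyω hprod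
  have h := hprod.sub (((hxω.sub_const (∫ ω, x ω 0 ∂P)).const_mul c).mul
    (hyω.sub_const (∫ ω, y ω 0 ∂P)))
  simp only [sub_self, mul_zero, sub_zero] at h
  refine h.congr' ?_
  filter_upwards [eventually_ne_atTop 0] with n hn
  rw [S_eq_mean_sub hc (∫ ω, x ω 0 ∂P) (∫ ω, y ω 0 ∂P) _ _ hn]

lemma IID.ae_tendsto_mean_s_sub_sq (hxy : IID P fun i ω => (x ω i, y ω i))
    (hx : MemLp (fun ω => x ω 0) 2 P) (hy : MemLp (fun ω => y ω 0) 2 P)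
    (h2 : MemLp (centredMul P c (x · 0) (y · 0)) 2 P) (κ : ℝ) :
    ∀ᵐ ω ∂P, Tendsto (fun n => mean (fun i => (s c (x ω) (y ω) n i - κ) ^ 2) n) atTop
      (𝓝 (∫ ω, (centredMul P c (x · 0) (y · 0) ω - κ) ^ 2 ∂P)) := by
  have hX := hxy.comp measurable_fst
  have hY := hxy.comp measurable_snd
  filter_upwards [hX.ae_tendsto_mean (hx.integrable one_le_two),
    hY.ae_tendsto_mean (hy.integrable one_le_two),
    hX.ae_tendsto_mean_sub_sq hx (c * ∫ ω, x ω 0 ∂P),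
    hY.ae_tendsto_mean_sub_sq hy (c * ∫ ω, y ω 0 ∂P),
    (hxy.sub_mul_sub _ _).ae_tendsto_mean_sub_sq h2 κ] with ω hxω hyω hx2 hy2 hprod
  exact tendsto_mean_s_sub_sq hxω hyω hx2 hy2 hprod

-- The correction `c √n (mean x - E x) (mean y - E y)` is a product of a sequence converging in
-- distribution and one converging to zero, so it does not affect the limit.
lemma IID.tendstoInDistribution_sqrt_mul_S_sub (hxy : IID P fun i ω => (x ω i, y ω i))
    (hc : c ^ 2 = c) (hx : MemLp (fun ω => x ω 0) 2 P) (hy : MemLp (fun ω => y ω 0) 2 P)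
    (h2 : MemLp (centredMul P c (x · 0) (y · 0)) 2 P) :
    TendstoInDistribution
      (fun (n : ℕ) ω =>
        √n * (S c (x ω) (y ω) n - ∫ ω, centredMul P c (x · 0) (y · 0) ω ∂P)) atTop
      (fun t : ℝ => √(Var[centredMul P c (x · 0) (y · 0); P]) * t)
      (fun _ => P) (gaussianReal 0 1) := by
  have hX := hxy.comp measurable_fst
  have hY := hxy.comp measurable_snd
  have main : TendstoInDistribution
      (fun (n : ℕ) ω =>
        √n * (mean (fun i => (x ω i - c * ∫ ω, x ω 0 ∂P) * (y ω i - c * ∫ ω, y ω 0 ∂P)) n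
          - ∫ ω, centredMul P c (x · 0) (y · 0) ω ∂P)) atTop
      (fun t : ℝ => √(Var[centredMul P c (x · 0) (y · 0); P]) * t)
      (fun _ => P) (gaussianReal 0 1) :=
    (hxy.sub_mul_sub _ _).tendstoInDistribution_sqrt_mul_mean_sub h2
  have mY : Measurable y := measurable_pi_iff.2 hY.measurable
  have hYlim : ∀ᵐ ω ∂P,
      Tendsto (fun n => -(c * (mean (y ω) n - ∫ ω, y ω 0 ∂P))) atTop (𝓝 0) := by
    filter_upwards [hY.ae_tendsto_mean (hy.integrable one_le_two)] with ω hω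
    simpa using ((hω.sub_const (∫ ω, y ω 0 ∂P)).const_mul c).neg
  have correction := tendstoInDistribution_mul_of_ae_tendsto
    (hX.tendstoInDistribution_sqrt_mul_mean_sub hx) (fun n => by fun_prop) hYlim
  simp only [mul_zero] at correction
  have sum := main.add_of_tendstoInMeasure_const
    (tendstoInMeasure_zero_of_tendstoInDistribution correction)
    fun n => correction.forall_aemeasurable n
  simp only [add_zero] at sum
  convert! sum using 3 with n ω
  rcases eq_or_ne n 0 with rfl | hn
  · simp
  · rw [S_eq_mean_sub hc (∫ ω, x ω 0 ∂P) (∫ ω, y ω 0 ∂P) _ _ hn]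
    simp only [Pi.add_apply]
    ring

end SamplePair

section SlopeCondition

variable {Ω : Type*} [MeasurableSpace Ω] {P : Measure Ω} {c dd mu β : ℝ} {x y : Ω → ℕ → ℝ}

/-- The conditions on i.i.d. pairs `(x_i, y_i)` under which the interval is asymptotically exact for
the slope `β`: the population versions of the numerator and the denominator of `betaHat` are
positive and nonzero and have the quotient `β`, and the score `centredMul P c y (y - β x)`, which is
the population version of `u_i(β)` up to an additive constant, has a finite positive variance. -/
structure SlopeCondition (P : Measure Ω) (c dd mu β : ℝ) (x y : Ω → ℕ → ℝ) : Prop where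
  sq_eq : c ^ 2 = c
  iid : IID P fun i ω => (x ω i, y ω i)
  memLp_x : MemLp (fun ω => x ω 0) 2 P
  memLp_y : MemLp (fun ω => y ω 0) 2 P
  memLp_score : MemLp (centredMul P c (y · 0) fun ω => y ω 0 - β * x ω 0) 2 P
  variance_score_pos : 0 < Var[centredMul P c (y · 0) fun ω => y ω 0 - β * x ω 0; P]
  denominator_ne_zero : ∫ ω, centredMul P c (x · 0) (y · 0) ω ∂P - mu ≠ 0
  numerator_pos : 0 < ∫ ω, centredMul P c (y · 0) (y · 0) ω ∂P - dd
  numerator_eq : ∫ ω, centredMul P c (y · 0) (y · 0) ω ∂P - dd =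
    β * (∫ ω, centredMul P c (x · 0) (y · 0) ω ∂P - mu)

namespace SlopeCondition

lemma measurable_x (h : SlopeCondition P c dd mu β x y) : Measurable x :=
  measurable_pi_iff.2 (h.iid.comp measurable_fst).measurable

lemma measurable_y (h : SlopeCondition P c dd mu β x y) : Measurable y :=
  measurable_pi_iff.2 (h.iid.comp measurable_snd).measurable

lemma iid_y_y (h : SlopeCondition P c dd mu β x y) : IID P fun i ω => (y ω i, y ω i) :=
  h.iid.comp (g := fun p => (p.2, p.2)) (by fun_prop)

lemma iid_y_sub (h : SlopeCondition P c dd mu β x y) :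
    IID P fun i ω => (y ω i, y ω i - β * x ω i) :=
  h.iid.comp (g := fun p => (p.2, p.2 - β * p.1)) (by fun_prop)

lemma memLp_y_sub (h : SlopeCondition P c dd mu β x y) :
    MemLp (fun ω => y ω 0 - β * x ω 0) 2 P :=
  h.memLp_y.sub (h.memLp_x.const_mul β)

variable [IsProbabilityMeasure P]

lemma integral_y_sub (h : SlopeCondition P c dd mu β x y) :
    ∫ ω, y ω 0 - β * x ω 0 ∂P = ∫ ω, y ω 0 ∂P - β * ∫ ω, x ω 0 ∂P := by
  rw [integral_sub (h.memLp_y.integrable one_le_two)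
    ((h.memLp_x.integrable one_le_two).const_mul β), integral_const_mul]

lemma integral_score (h : SlopeCondition P c dd mu β x y) :
    ∫ ω, centredMul P c (y · 0) (fun ω => y ω 0 - β * x ω 0) ω ∂P = dd - β * mu := by
  rw [centredMul_sub_const_mul β (h.memLp_x.integrable one_le_two)
    (h.memLp_y.integrable one_le_two), integral_sub (integrable_centredMul h.memLp_y h.memLp_y)
    ((integrable_centredMul h.memLp_x h.memLp_y).const_mul β), integral_const_mul]
  linarith [h.numerator_eq]

lemma ae_tendsto_S_xy (h : SlopeCondition P c dd mu β x y) :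
    ∀ᵐ ω ∂P, Tendsto (S c (x ω) (y ω)) atTop (𝓝 (∫ ω, centredMul P c (x · 0) (y · 0) ω ∂P)) :=
  h.iid.ae_tendsto_S h.sq_eq h.memLp_x h.memLp_y

lemma ae_tendsto_S_yy (h : SlopeCondition P c dd mu β x y) :
    ∀ᵐ ω ∂P, Tendsto (S c (y ω) (y ω)) atTop (𝓝 (∫ ω, centredMul P c (y · 0) (y · 0) ω ∂P)) :=
  h.iid_y_y.ae_tendsto_S h.sq_eq h.memLp_y h.memLp_y

lemma ae_eventually_betaHatDefined (h : SlopeCondition P c dd mu β x y) :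
    ∀ᵐ ω ∂P, ∀ᶠ n in atTop, BetaHatDefined c dd mu (x ω) (y ω) n := by
  filter_upwards [h.ae_tendsto_S_xy, h.ae_tendsto_S_yy] with ω hxy hyy
  exact ((hxy.sub_const mu).eventually_ne h.denominator_ne_zero).and
    ((hyy.sub_const dd).eventually (lt_mem_nhds h.numerator_pos))

lemma ae_eventually_denom_pos (h : SlopeCondition P c dd mu β x y) (k : Kind) (z : ℝ) :
    ∀ᵐ ω ∂P, ∀ᶠ n in atTop, 0 < denom k c mu z (x ω) (y ω) n := by
  have hX := h.iid.comp measurable_fst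
  have hY := h.iid.comp measurable_snd
  filter_upwards [hX.ae_tendsto_mean (h.memLp_x.integrable one_le_two),
    hY.ae_tendsto_mean (h.memLp_y.integrable one_le_two),
    hX.ae_tendsto_mean_sub_sq h.memLp_x (c * ∫ ω, x ω 0 ∂P),
    hY.ae_tendsto_mean_sub_sq h.memLp_y (c * ∫ ω, y ω 0 ∂P), h.ae_tendsto_S_xy]
    with ω hxω hyω hx2 hy2 hS
  exact eventually_denom_pos k z hxω hyω hx2 hy2 hS h.denominator_ne_zero

lemma ae_eventually_intervalDefined (h : SlopeCondition P c dd mu β x y) (k : Kind) (z : ℝ) :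
    ∀ᵐ ω ∂P, ∀ᶠ n in atTop, IntervalDefined k c dd mu z (x ω) (y ω) n := by
  filter_upwards [h.ae_eventually_betaHatDefined, h.ae_eventually_denom_pos k z] with ω hβ hden
  filter_upwards [hβ, hden] with n hβn hdenn
  exact intervalDefined_of_denom_pos hβn hdenn

lemma integral_score_sub_sq (h : SlopeCondition P c dd mu β x y) :
    ∫ ω, (centredMul P c (y · 0) (fun ω => y ω 0 - β * x ω 0) ω - (dd - β * mu)) ^ 2 ∂P =
      Var[centredMul P c (y · 0) fun ω => y ω 0 - β * x ω 0; P] := by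
  rw [variance_eq_integral h.memLp_score.1.aemeasurable, h.integral_score]

lemma ae_eventually_residSq_betaHat_pos (h : SlopeCondition P c dd mu β x y) (k : Kind) :
    ∀ᵐ ω ∂P, ∀ᶠ n in atTop,
      0 < residSq k (betaHat c dd mu (x ω) (y ω) n) c dd mu (x ω) (y ω) n := by
  have hscore := (h.iid_y_sub.sub_mul_sub (c * ∫ ω, y ω 0 ∂P)
    (c * ∫ ω, y ω 0 - β * x ω 0 ∂P)).ae_tendsto_mean_sub_sq h.memLp_score (dd - β * mu)
  filter_upwards [(h.iid.comp measurable_fst).ae_tendsto_mean (h.memLp_x.integrable one_le_two),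
    (h.iid.comp measurable_snd).ae_tendsto_mean (h.memLp_y.integrable one_le_two),
    h.ae_tendsto_S_xy, h.ae_tendsto_S_yy, hscore] with ω hxω hyω hxy hyy hL
  rw [h.integral_y_sub] at hL
  refine eventually_residSq_betaHat_pos k hxω hyω
    ((hxy.sub_const mu).eventually_ne h.denominator_ne_zero)
    (tendsto_betaHat hxy hyy h.denominator_ne_zero h.numerator_eq) hL ?_
  simpa only [centredMul, h.integral_y_sub] using
    h.integral_score_sub_sq.trans_ne h.variance_score_pos.ne'

lemma ae_tendsto_residSq_div (h : SlopeCondition P c dd mu β x y) (k : Kind) :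
    ∀ᵐ ω ∂P, Tendsto (fun n : ℕ => residSq k β c dd mu (x ω) (y ω) n / n) atTop
      (𝓝 (Var[centredMul P c (y · 0) fun ω => y ω 0 - β * x ω 0; P])) := by
  filter_upwards [h.iid_y_sub.ae_tendsto_S h.sq_eq h.memLp_y h.memLp_y_sub,
    h.iid_y_sub.ae_tendsto_mean_s_sub_sq h.memLp_y h.memLp_y_sub h.memLp_score (dd - β * mu)]
    with ω hS hL
  rw [h.integral_score] at hS
  rw [h.integral_score_sub_sq] at hL
  exact tendsto_residSq_div k β hS hL

lemma tendstoInDistribution_pivot (h : SlopeCondition P c dd mu β x y) (k : Kind) :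
    TendstoInDistribution (fun n ω => pivot k β c dd mu (x ω) (y ω) n) atTop (fun t : ℝ => t)
      (fun _ => P) (gaussianReal 0 1) := by
  set σ2 := Var[centredMul P c (y · 0) fun ω => y ω 0 - β * x ω 0; P] with hσ2
  have hσ : √σ2 ≠ 0 := (Real.sqrt_pos.2 h.variance_score_pos).ne'
  have numerator := h.iid_y_sub.tendstoInDistribution_sqrt_mul_S_sub h.sq_eq h.memLp_y
    h.memLp_y_sub h.memLp_score
  rw [h.integral_score, ← hσ2] at numerator
  have normalizer : ∀ᵐ ω ∂P, Tendsto (fun n : ℕ =>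
      √(f k n / (n : ℝ) ^ 2) / √(residSq k β c dd mu (x ω) (y ω) n / n)) atTop
      (𝓝 (√1 / √σ2)) := by
    filter_upwards [h.ae_tendsto_residSq_div k] with ω hω
    exact (tendsto_f_div k).sqrt.div hω.sqrt hσ
  have mx := h.measurable_x
  have my := h.measurable_y
  convert! tendstoInDistribution_mul_of_ae_tendsto numerator (fun n => by fun_prop) normalizer
    using 3 with n ω t
  · rcases eq_or_ne n 0 with rfl | hn
    · simp [pivot, mean]
    · rw [pivot, mean_u_eq_S_sub hn, Real.sqrt_div' _ (by positivity),
        Real.sqrt_div' _ (by positivity), Real.sqrt_sq n.cast_nonneg, div_div_div_eq,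
        mul_div_assoc',
        show ∀ a U : ℝ, √(n : ℝ) * U * (a * √(n : ℝ)) = n * (a * U) from fun a U => by
          linear_combination a * U * Real.mul_self_sqrt n.cast_nonneg,
        mul_div_mul_left _ _ (Nat.cast_ne_zero.2 hn)]
  · rw [Real.sqrt_one]
    field_simp

lemma tendsto_measureReal_mem_interval (h : SlopeCondition P c dd mu β x y) (k : Kind) {z : ℝ}
    (hz : 0 ≤ z) :
    Tendsto (fun n => P.real {ω | IntervalDefined k c dd mu z (x ω) (y ω) n ∧
        β ∈ interval k c dd mu z (x ω) (y ω) n}) atTop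
      (𝓝 (2 * cdf (gaussianReal 0 1) z - 1)) := by
  have mx := h.measurable_x
  have my := h.measurable_y
  have hpivot := h.tendstoInDistribution_pivot k
  have := nullSingletonClass_gaussianReal (μ := 0) one_ne_zero
  have hlim := tendsto_measureReal_preimage hpivot (measurableSet_Icc (a := -z) (b := z)) (by
    rw [frontier_Icc (by linarith)]
    exact (Set.toFinite {-z, z}).measure_zero _)
  rw [← gaussianReal_real_Icc_neg hz]
  refine tendsto_measureReal_congr (fun n =>
    ((measurableSet_intervalDefined k c dd mu z mx my n).inter
      (measurableSet_mem_interval k β c dd mu z mx my n)).nullMeasurableSet)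
    (fun n => (hpivot.forall_aemeasurable n).nullMeasurable measurableSet_Icc) hlim ?_
  filter_upwards [h.ae_eventually_intervalDefined k z, h.ae_eventually_denom_pos k z,
    h.ae_tendsto_residSq_div k] with ω hdef hden hres
  filter_upwards [hdef, hden, hres.eventually (lt_mem_nhds h.variance_score_pos),
    eventually_ge_atTop 2] with n hdefn hdenn hresn hn
  have hV := (div_pos_iff_of_pos_right (by positivity)).1 hresn
  exact (and_iff_right hdefn).trans
    (mem_interval_iff_pivot_mem_Icc hn hdefn.1.1 hz hdenn hV)

lemma tendsto_measureReal_interval_eq_pivotSet (h : SlopeCondition P c dd mu β x y) (k : Kind)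
    {z : ℝ} (hz : 0 < z) :
    Tendsto (fun n => P.real {ω | IntervalDefined k c dd mu z (x ω) (y ω) n ∧
        B k 1 c dd mu z (x ω) (y ω) n < B k 2 c dd mu z (x ω) (y ω) n ∧
        interval k c dd mu z (x ω) (y ω) n = pivotSet k c dd mu z (x ω) (y ω) n}) atTop (𝓝 1) := by
  refine tendsto_measureReal_one_of_ae_eventually ?_
  filter_upwards [h.ae_eventually_intervalDefined k z, h.ae_eventually_denom_pos k z,
    h.ae_eventually_residSq_betaHat_pos k] with ω hdef hden hres
  filter_upwards [hdef, hden, hres, eventually_ge_atTop 2] with n hdefn hdenn hresn hn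
  exact ⟨hdefn, B_one_lt_B_two hz hdenn hresn, interval_eq_pivotSet hn hdefn.1.1 hz.le hdenn⟩

end SlopeCondition

end SlopeCondition

section Moments

variable {Ω : Type*} [MeasurableSpace Ω] {P : Measure Ω}

lemma memLp_ofReal_of_integrable_abs_rpow {q : ℝ} (hq : 0 < q) {f : Ω → ℝ}
    (hf : AEStronglyMeasurable f P) (h : Integrable (fun ω => |f ω| ^ q) P) :
    MemLp f (ENNReal.ofReal q) P := by
  rw [← integrable_norm_rpow_iff hf (by simpa using hq) ENNReal.ofReal_ne_top,
    ENNReal.toReal_ofReal hq.le]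
  exact h

lemma memLp_four_of_integrable_pow {f : Ω → ℝ} (hf : AEStronglyMeasurable f P)
    (h : Integrable (fun ω => f ω ^ 4) P) : MemLp f 4 P := by
  have := memLp_ofReal_of_integrable_abs_rpow (q := (4 : ℕ)) (by norm_num) hf
    (h.congr (.of_forall fun ω => by
      simp only [Real.rpow_natCast, Even.pow_abs (by decide : Even 4)]))
  simpa using this

lemma memLp_two_mul_of_memLp_four {f g : Ω → ℝ} (hf : MemLp f 4 P) (hg : MemLp g 4 P) :
    MemLp (fun ω => f ω * g ω) 2 P := by
  have : ENNReal.HolderTriple 4 4 2 := ⟨by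
    rw [← two_mul, show (4 : ENNReal) = 2 * 2 by norm_num,
      ENNReal.mul_inv (by simp) (by simp), ← mul_assoc,
      ENNReal.mul_inv_cancel (by simp) (by simp), one_mul]⟩
  exact hg.mul hf

lemma memLp_two_mul_of_indepFun {f g : Ω → ℝ} (hf : MemLp f 2 P) (hg : MemLp g 2 P)
    (h : IndepFun f g P) : MemLp (fun ω => f ω * g ω) 2 P := by
  refine (memLp_two_iff_integrable_sq (hf.1.mul hg.1)).2 ?_
  have := (h.comp (measurable_id.pow_const 2) (measurable_id.pow_const 2)).integrable_mul
    hf.integrable_sq hg.integrable_sq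
  exact this.congr (.of_forall fun ω => (mul_pow (f ω) (g ω) 2).symm)

lemma variance_mul_add_of_indepFun [IsProbabilityMeasure P] {X f g : Ω → ℝ} (hX : MemLp X 2 P)
    (hX0 : ∫ ω, X ω ∂P = 0) (hf : MemLp f 2 P) (hg : MemLp g 2 P)
    (h : IndepFun X (fun ω => (f ω, g ω)) P) :
    Var[fun ω => X ω * f ω + g ω; P] = (∫ ω, X ω ^ 2 ∂P) * ∫ ω, f ω ^ 2 ∂P + Var[g; P] := by
  have hXf : IndepFun X f P := h.comp measurable_id measurable_fst
  have hXfg : IndepFun X (fun ω => f ω * g ω) P :=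
    h.comp (ψ := fun p : ℝ × ℝ => p.1 * p.2) measurable_id (by fun_prop)
  have hXsq : IndepFun (fun ω => X ω ^ 2) (fun ω => f ω ^ 2) P :=
    hXf.comp (measurable_id.pow_const 2) (measurable_id.pow_const 2)
  have hmul := memLp_two_mul_of_indepFun hX hf hXf
  have mean_mul : ∫ ω, X ω * f ω ∂P = 0 := by
    rw [hXf.integral_fun_mul_eq_mul_integral hX.1 hf.1, hX0, zero_mul]
  have cov_zero : cov[fun ω => X ω * f ω, g; P] = 0 := by
    rw [covariance_eq_sub hmul hg, mean_mul, zero_mul, sub_zero]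
    simp only [Pi.mul_apply, mul_assoc]
    rw [hXfg.integral_fun_mul_eq_mul_integral hX.1 (hf.1.mul hg.1), hX0, zero_mul]
  rw [variance_fun_add hmul hg, cov_zero,
    variance_of_integral_eq_zero hmul.1.aemeasurable mean_mul]
  simp only [mul_pow]
  rw [hXsq.integral_fun_mul_eq_mul_integral (hX.1.pow 2) (hf.1.pow 2), mul_zero, add_zero]

end Moments

section Model

variable {Ω : Type*} [MeasurableSpace Ω] {P : Measure Ω} {ξ δ ε : ℕ → Ω → ℝ}
  {β α lam θ mu c : ℝ}

namespace ErrorCondition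

lemma memLp_four_δ (hA : ErrorCondition P δ ε lam θ mu) : MemLp (δ 0) 4 P :=
  memLp_four_of_integrable_pow (measurable_fst.comp (hA.iid.measurable 0)).aestronglyMeasurable
    hA.integrable_δ

lemma memLp_four_ε (hA : ErrorCondition P δ ε lam θ mu) : MemLp (ε 0) 4 P :=
  memLp_four_of_integrable_pow (measurable_snd.comp (hA.iid.measurable 0)).aestronglyMeasurable
    hA.integrable_ε

lemma memLp_four_sub (hA : ErrorCondition P δ ε lam θ mu) (β : ℝ) :
    MemLp (fun ω => δ 0 ω - β * ε 0 ω) 4 P :=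
  hA.memLp_four_δ.sub (hA.memLp_four_ε.const_mul β)

variable [IsProbabilityMeasure P]

lemma memLp_δ (hA : ErrorCondition P δ ε lam θ mu) : MemLp (δ 0) 2 P :=
  hA.memLp_four_δ.mono_exponent (by norm_num)

lemma memLp_ε (hA : ErrorCondition P δ ε lam θ mu) : MemLp (ε 0) 2 P :=
  hA.memLp_four_ε.mono_exponent (by norm_num)

lemma memLp_sub (hA : ErrorCondition P δ ε lam θ mu) (β : ℝ) :
    MemLp (fun ω => δ 0 ω - β * ε 0 ω) 2 P :=
  hA.memLp_δ.sub (hA.memLp_ε.const_mul β)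

lemma memLp_add_const_mul_sub (hA : ErrorCondition P δ ε lam θ mu) (r β : ℝ) :
    MemLp (fun ω => (δ 0 ω + r) * (δ 0 ω - β * ε 0 ω)) 2 P :=
  memLp_two_mul_of_memLp_four (hA.memLp_four_δ.add (memLp_const r)) (hA.memLp_four_sub β)

lemma integral_sub_eq_zero (hA : ErrorCondition P δ ε lam θ mu) (β : ℝ) :
    ∫ ω, δ 0 ω - β * ε 0 ω ∂P = 0 := by
  rw [integral_sub (hA.memLp_δ.integrable one_le_two)
    ((hA.memLp_ε.const_mul β).integrable one_le_two), integral_const_mul, hA.mean_δ, hA.mean_ε,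
    mul_zero, sub_zero]

lemma integral_sub_sq_pos (hA : ErrorCondition P δ ε lam θ mu) (β : ℝ) :
    0 < ∫ ω, (δ 0 ω - β * ε 0 ω) ^ 2 ∂P := by
  have hpos := hA.posDef.dotProduct_mulVec_pos (x := ![1, -β])
    fun h => one_ne_zero (congrFun h 0)
  have hvar := variance_fun_sub hA.memLp_δ (hA.memLp_ε.const_mul β)
  rw [variance_of_integral_eq_zero (hA.memLp_sub β).1.aemeasurable (hA.integral_sub_eq_zero β),
    covariance_const_mul_right, variance_const_mul, hA.var_δ, hA.cov_δε, hA.var_ε] at hvar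
  simp [Matrix.mulVec, dotProduct, Fin.sum_univ_two] at hpos
  linarith

end ErrorCondition

variable [IsProbabilityMeasure P]

lemma memLp_obsX (hA : ErrorCondition P δ ε lam θ mu) (hξ2 : MemLp (ξ 0) 2 P) :
    MemLp (fun ω => obsX ξ ε ω 0) 2 P :=
  hξ2.add hA.memLp_ε

lemma memLp_obsY (hA : ErrorCondition P δ ε lam θ mu) (hξ2 : MemLp (ξ 0) 2 P) (β α : ℝ) :
    MemLp (fun ω => obsY β α ξ δ ω 0) 2 P :=
  ((hξ2.const_mul β).add (memLp_const α)).add hA.memLp_δ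

lemma integral_obsX (hA : ErrorCondition P δ ε lam θ mu) (hξ2 : MemLp (ξ 0) 2 P) :
    ∫ ω, obsX ξ ε ω 0 ∂P = ∫ ω, ξ 0 ω ∂P := by
  simp only [obsX]
  rw [integral_add (hξ2.integrable one_le_two) (hA.memLp_ε.integrable one_le_two), hA.mean_ε,
    add_zero]

lemma integral_obsY (hA : ErrorCondition P δ ε lam θ mu) (hξ2 : MemLp (ξ 0) 2 P) (β α : ℝ) :
    ∫ ω, obsY β α ξ δ ω 0 ∂P = β * ∫ ω, ξ 0 ω ∂P + α := by
  have hξ1 := (hξ2.integrable one_le_two).const_mul β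
  have hline : Integrable (fun ω => β * ξ 0 ω + α) P := hξ1.add (integrable_const α)
  simp only [obsY]
  rw [integral_add hline (hA.memLp_δ.integrable one_le_two),
    integral_add hξ1 (integrable_const α), integral_const_mul, hA.mean_δ, integral_const,
    probReal_univ, one_smul, add_zero]

lemma covariance_obsX_obsY (hA : ErrorCondition P δ ε lam θ mu) (hξ2 : MemLp (ξ 0) 2 P)
    (hind : IndepFun (ξ 0) (fun ω => (δ 0 ω, ε 0 ω)) P) (β α : ℝ) :
    cov[fun ω => obsX ξ ε ω 0, fun ω => obsY β α ξ δ ω 0; P] = β * Var[ξ 0; P] + mu := by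
  have hβξ := hξ2.const_mul β
  have hline := hβξ.add (memLp_const α)
  have hξδ : cov[ξ 0, δ 0; P] = 0 :=
    (hind.comp measurable_id measurable_fst).covariance_eq_zero hξ2 hA.memLp_δ
  have hεξ : cov[ε 0, ξ 0; P] = 0 :=
    (hind.comp measurable_id measurable_snd).symm.covariance_eq_zero hA.memLp_ε hξ2
  have hcov {Z : Ω → ℝ} (hZ : MemLp Z 2 P) :
      cov[Z, fun ω => obsY β α ξ δ ω 0; P] = β * cov[Z, ξ 0; P] + cov[Z, δ 0; P] := by
    have := covariance_add_right hZ hline hA.memLp_δ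
    rwa [show cov[Z, (fun ω => β * ξ 0 ω) + fun _ => α; P] = β * cov[Z, ξ 0; P] from
      (covariance_add_const_right (hβξ.integrable one_le_two) α).trans
        (covariance_const_mul_right β)] at this
  have := covariance_add_left hξ2 hA.memLp_ε (memLp_obsY hA hξ2 β α)
  rw [hcov hξ2, hcov hA.memLp_ε, hξδ, hεξ, covariance_self hξ2.1.aemeasurable,
    covariance_comm (ε 0), hA.cov_δε, mul_zero, zero_add, add_zero] at this
  exact this

lemma variance_obsY (hA : ErrorCondition P δ ε lam θ mu) (hξ2 : MemLp (ξ 0) 2 P)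
    (hind : IndepFun (ξ 0) (fun ω => (δ 0 ω, ε 0 ω)) P) (β α : ℝ) :
    Var[fun ω => obsY β α ξ δ ω 0; P] = β ^ 2 * Var[ξ 0; P] + lam * θ := by
  have hβξ := hξ2.const_mul β
  have hline : MemLp (fun ω => β * ξ 0 ω + α) 2 P := hβξ.add (memLp_const α)
  have hindep : IndepFun (fun ω => β * ξ 0 ω + α) (δ 0) P :=
    hind.comp (φ := fun t => β * t + α) (by fun_prop) measurable_fst
  simp only [obsY]
  rw [hindep.variance_fun_add hline hA.memLp_δ, variance_add_const hβξ.1,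
    variance_const_mul, hA.var_δ]

lemma score_obs_eq (hA : ErrorCondition P δ ε lam θ mu) (hξ2 : MemLp (ξ 0) 2 P)
    (hα : (1 - c) * α = 0) :
    centredMul P c (obsY β α ξ δ · 0) (fun ω => obsY β α ξ δ ω 0 - β * obsX ξ ε ω 0) =
      fun ω => β * (ξ 0 ω - ∫ ω, ξ 0 ω ∂P) * (δ 0 ω - β * ε 0 ω) +
        (δ 0 ω + (1 - c) * (β * ∫ ω, ξ 0 ω ∂P)) * (δ 0 ω - β * ε 0 ω) := by
  have residual (ω : Ω) : obsY β α ξ δ ω 0 - β * obsX ξ ε ω 0 = α + (δ 0 ω - β * ε 0 ω) := by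
    simp only [obsX, obsY]
    ring
  ext ω
  simp only [centredMul, integral_obsY hA hξ2, residual]
  rw [integral_add (integrable_const α) ((hA.memLp_sub β).integrable one_le_two),
    hA.integral_sub_eq_zero, integral_const, probReal_univ, one_smul, obsY]
  linear_combination (β * (ξ 0 ω - c * ∫ ω, ξ 0 ω ∂P) + (1 - c) * α + 2 * δ 0 ω - β * ε 0 ω) * hα

lemma memLp_score_obs (hA : ErrorCondition P δ ε lam θ mu) (hξ2 : MemLp (ξ 0) 2 P)
    (hind : IndepFun (ξ 0) (fun ω => (δ 0 ω, ε 0 ω)) P) (hα : (1 - c) * α = 0) :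
    MemLp (centredMul P c (obsY β α ξ δ · 0)
      fun ω => obsY β α ξ δ ω 0 - β * obsX ξ ε ω 0) 2 P := by
  rw [score_obs_eq hA hξ2 hα]
  refine (memLp_two_mul_of_indepFun ((hξ2.sub (memLp_const _)).const_mul β)
    (hA.memLp_sub β) ?_).add (hA.memLp_add_const_mul_sub _ β)
  exact hind.comp (φ := fun t => β * (t - ∫ ω, ξ 0 ω ∂P)) (ψ := fun p => p.1 - β * p.2)
    (by fun_prop) (by fun_prop)

lemma variance_score_obs_pos (hA : ErrorCondition P δ ε lam θ mu) (hξ2 : MemLp (ξ 0) 2 P)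
    (hξvar : 0 < Var[ξ 0; P]) (hind : IndepFun (ξ 0) (fun ω => (δ 0 ω, ε 0 ω)) P) (hβ : β ≠ 0)
    (hα : (1 - c) * α = 0) :
    0 < Var[centredMul P c (obsY β α ξ δ · 0)
      fun ω => obsY β α ξ δ ω 0 - β * obsX ξ ε ω 0; P] := by
  set m := ∫ ω, ξ 0 ω ∂P with hm
  have hξm : MemLp (fun ω => β * (ξ 0 ω - m)) 2 P := (hξ2.sub (memLp_const m)).const_mul β
  have centred : ∫ ω, β * (ξ 0 ω - m) ∂P = 0 := by
    rw [integral_const_mul, integral_sub (hξ2.integrable one_le_two) (integrable_const m),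
      integral_const, probReal_univ, one_smul, ← hm, sub_self, mul_zero]
  have second_moment : ∫ ω, (β * (ξ 0 ω - m)) ^ 2 ∂P = β ^ 2 * Var[ξ 0; P] := by
    simp only [mul_pow]
    rw [integral_const_mul, variance_eq_integral hξ2.1.aemeasurable]
  rw [score_obs_eq hA hξ2 hα, variance_mul_add_of_indepFun hξm centred
    (hA.memLp_sub β) (hA.memLp_add_const_mul_sub _ β), second_moment]
  · have := hA.integral_sub_sq_pos β
    have := variance_nonneg
      (fun ω => (δ 0 ω + (1 - c) * (β * m)) * (δ 0 ω - β * ε 0 ω)) P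
    positivity
  · exact hind.comp (φ := fun t => β * (t - m))
      (ψ := fun p => (p.1 - β * p.2, (p.1 + (1 - c) * (β * m)) * (p.1 - β * p.2)))
      (by fun_prop) (by fun_prop)

lemma integral_centredMul_obsX_obsY_sub (hA : ErrorCondition P δ ε lam θ mu)
    (hξ2 : MemLp (ξ 0) 2 P) (hind : IndepFun (ξ 0) (fun ω => (δ 0 ω, ε 0 ω)) P) (hc : c ^ 2 = c)
    (hα : (1 - c) * α = 0) :
    ∫ ω, centredMul P c (obsX ξ ε · 0) (obsY β α ξ δ · 0) ω ∂P - mu =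
      β * (Var[ξ 0; P] + (1 - c) * (∫ ω, ξ 0 ω ∂P) ^ 2) := by
  rw [integral_centredMul hc (memLp_obsX hA hξ2) (memLp_obsY hA hξ2 β α),
    covariance_obsX_obsY hA hξ2 hind, integral_obsX hA hξ2, integral_obsY hA hξ2]
  linear_combination (∫ ω, ξ 0 ω ∂P) * hα

lemma integral_centredMul_obsY_obsY_sub (hA : ErrorCondition P δ ε lam θ mu)
    (hξ2 : MemLp (ξ 0) 2 P) (hind : IndepFun (ξ 0) (fun ω => (δ 0 ω, ε 0 ω)) P) (hc : c ^ 2 = c)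
    (hα : (1 - c) * α = 0) :
    ∫ ω, centredMul P c (obsY β α ξ δ · 0) (obsY β α ξ δ · 0) ω ∂P - lam * θ =
      β ^ 2 * (Var[ξ 0; P] + (1 - c) * (∫ ω, ξ 0 ω ∂P) ^ 2) := by
  have hY := memLp_obsY hA hξ2 β α
  rw [integral_centredMul hc hY hY, covariance_self hY.1.aemeasurable,
    variance_obsY hA hξ2 hind, integral_obsY hA hξ2]
  linear_combination (2 * β * (∫ ω, ξ 0 ω ∂P) + α) * hα

theorem slopeCondition_obs (hA : ErrorCondition P δ ε lam θ mu) (hξ : IID P ξ)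
    (hξ2 : MemLp (ξ 0) 2 P) (hξvar : 0 < Var[ξ 0; P])
    (hC : IndepFun (fun ω i => (δ i ω, ε i ω)) (fun ω i => ξ i ω) P) (hβ : β ≠ 0)
    (hc : c ^ 2 = c) (hα : (1 - c) * α = 0) :
    SlopeCondition P c (lam * θ) mu β (obsX ξ ε) (obsY β α ξ δ) := by
  have hind : IndepFun (ξ 0) (fun ω => (δ 0 ω, ε 0 ω)) P :=
    (hC.comp (measurable_pi_apply 0) (measurable_pi_apply 0)).symm
  have hxy := integral_centredMul_obsX_obsY_sub (β := β) hA hξ2 hind hc hα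
  have hyy := integral_centredMul_obsY_obsY_sub (β := β) hA hξ2 hind hc hα
  have spread_pos : 0 < Var[ξ 0; P] + (1 - c) * (∫ ω, ξ 0 ω ∂P) ^ 2 := by
    have : 0 ≤ 1 - c := by nlinarith [sq_nonneg (1 - c)]
    positivity
  exact
    { sq_eq := hc
      iid := (hξ.prodMk hA.iid hC.symm).comp
        (g := fun p => (p.1 + p.2.2, β * p.1 + α + p.2.1)) (by fun_prop)
      memLp_x := memLp_obsX hA hξ2
      memLp_y := memLp_obsY hA hξ2 β α
      memLp_score := memLp_score_obs hA hξ2 hind hα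
      variance_score_pos := variance_score_obs_pos hA hξ2 hξvar hind hβ hα
      denominator_ne_zero := hxy ▸ mul_ne_zero hβ spread_pos.ne'
      numerator_pos := by rw [hyy]; positivity
      numerator_eq := by rw [hxy, hyy]; ring }

end Model

end SEIVM

theorem theorem4_general {Ω : Type*} [MeasurableSpace Ω] (P : Measure Ω) [IsProbabilityMeasure P]
    (ξ δ ε : ℕ → Ω → ℝ) (β α lam θ mu c : ℝ)
    (hA : SEIVM.ErrorCondition P δ ε lam θ mu) (hξ : SEIVM.IID P ξ)
    (hξvar : 0 < Var[ξ 0; P]) (hξ2 : MemLp (ξ 0) 2 P)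
    (hC : IndepFun (fun ω i => (δ i ω, ε i ω)) (fun ω i => ξ i ω) P)
    (hβ : β ≠ 0) (hc : (c = 0 ∧ α = 0) ∨ c = 1) :
    SEIVM.IIDInDAN P ξ ∧
    ∀ (γ z : ℝ), γ < 1 → cdf (gaussianReal 0 1) z = 1 - γ / 2 →
      ∀ k : SEIVM.Kind,
        Tendsto (fun n : ℕ => P.real {ω |
            SEIVM.IntervalDefined k c (lam * θ) mu z (SEIVM.obsX ξ ε ω) (SEIVM.obsY β α ξ δ ω) n ∧
            β ∈ SEIVM.interval k c (lam * θ) mu z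
              (SEIVM.obsX ξ ε ω) (SEIVM.obsY β α ξ δ ω) n})
          atTop (𝓝 (1 - γ)) ∧
        Tendsto (fun n : ℕ => P.real {ω |
            SEIVM.IntervalDefined k c (lam * θ) mu z (SEIVM.obsX ξ ε ω) (SEIVM.obsY β α ξ δ ω) n ∧
            SEIVM.B k 1 c (lam * θ) mu z (SEIVM.obsX ξ ε ω) (SEIVM.obsY β α ξ δ ω) n <
              SEIVM.B k 2 c (lam * θ) mu z (SEIVM.obsX ξ ε ω) (SEIVM.obsY β α ξ δ ω) n ∧
            SEIVM.interval k c (lam * θ) mu z (SEIVM.obsX ξ ε ω) (SEIVM.obsY β α ξ δ ω) n =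
              SEIVM.pivotSet k c (lam * θ) mu z (SEIVM.obsX ξ ε ω) (SEIVM.obsY β α ξ δ ω) n})
          atTop (𝓝 1) := by
  have slope : SEIVM.SlopeCondition P c (lam * θ) mu β (SEIVM.obsX ξ ε) (SEIVM.obsY β α ξ δ) :=
    SEIVM.slopeCondition_obs hA hξ hξ2 hξvar hC hβ (by rcases hc with ⟨rfl, -⟩ | rfl <;> norm_num)
      (by rcases hc with ⟨-, rfl⟩ | rfl <;> ring)
  refine ⟨hξ.inDAN hξ2 hξvar, fun γ z hγ hz k => ?_⟩
  have hz0 : 0 < z := SEIVM.pos_of_half_lt_cdf_gaussianReal one_ne_zero (by linarith)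
  have level : 2 * cdf (gaussianReal 0 1) z - 1 = 1 - γ := by rw [hz]; ring
  exact ⟨level ▸ slope.tendsto_measureReal_mem_interval k hz0.le,
    slope.tendsto_measureReal_interval_eq_pivotSet k hz0⟩

theorem theorem4 {Ω : Type*} [MeasurableSpace Ω] (P : Measure Ω) [IsProbabilityMeasure P]
    (ξ δ ε : ℕ → Ω → ℝ) (β α lam θ mu c : ℝ)
    -- the errors
    (hA : SEIVM.ErrorCondition P δ ε lam θ mu)
    -- the explanatory variables: i.i.d., non-degenerate, with a finite moment of order 8/3
    (hξ : SEIVM.IID P ξ)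
    (hξvar : 0 < Var[ξ 0; P])
    (hξmom : Integrable (fun ω => |ξ 0 ω| ^ (8 / 3 : ℝ)) P)
    -- the explanatory variables are independent of the errors
    (hC : IndepFun (fun ω i => (δ i ω, ε i ω)) (fun ω i => ξ i ω) P)
    (hβ : β ≠ 0)
    -- no intercept (`c = 0`), or unknown intercept (`c = 1`)
    (hc : (c = 0 ∧ α = 0) ∨ c = 1) :
    SEIVM.IIDInDAN P ξ ∧
    ∀ (γ z : ℝ), 0 < γ → γ < 1 → cdf (gaussianReal 0 1) z = 1 - γ / 2 →
      ∀ k : SEIVM.Kind,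
        Tendsto (fun n : ℕ => P.real {ω |
            SEIVM.IntervalDefined k c (lam * θ) mu z (SEIVM.obsX ξ ε ω) (SEIVM.obsY β α ξ δ ω) n ∧
            β ∈ SEIVM.interval k c (lam * θ) mu z
              (SEIVM.obsX ξ ε ω) (SEIVM.obsY β α ξ δ ω) n})
          atTop (𝓝 (1 - γ)) ∧
        Tendsto (fun n : ℕ => P.real {ω |
            SEIVM.IntervalDefined k c (lam * θ) mu z (SEIVM.obsX ξ ε ω) (SEIVM.obsY β α ξ δ ω) n ∧
            SEIVM.B k 1 c (lam * θ) mu z (SEIVM.obsX ξ ε ω) (SEIVM.obsY β α ξ δ ω) n <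
              SEIVM.B k 2 c (lam * θ) mu z (SEIVM.obsX ξ ε ω) (SEIVM.obsY β α ξ δ ω) n ∧
            SEIVM.interval k c (lam * θ) mu z (SEIVM.obsX ξ ε ω) (SEIVM.obsY β α ξ δ ω) n =
              SEIVM.pivotSet k c (lam * θ) mu z (SEIVM.obsX ξ ε ω) (SEIVM.obsY β α ξ δ ω) n})
          atTop (𝓝 1) := by
  have hξ2 : MemLp (ξ 0) 2 P :=
    (SEIVM.memLp_ofReal_of_integrable_abs_rpow (by norm_num)
      (hξ.measurable 0).aestronglyMeasurable hξmom).mono_exponent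
      (ENNReal.ofNat_le_ofReal.2 (by norm_num))
  have general := theorem4_general P ξ δ ε β α lam θ mu c hA hξ hξvar hξ2 hC hβ hc
  exact ⟨general.1, fun γ z _ => general.2 γ z⟩
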